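/- Let $F$ be an infinite field of characteristic $p\ge 0$. Permutations are composed from left to right and all modules are right modules. For $n\ge 0$ let $\omega_n=(1-c_n)(1-c_{n-1})\cdots(1-c_2)\in F\mathfrak S_n$, where $c_k=(k,k-1,\dots,1)$, and $\mathrm{Lie}_F(n)=\omega_nF\mathfrak S_n$. For a composition $q=(q_1,\dots,q_k)$ of $n$ (with positive parts) put $q_j^+=q_1+\cdots+q_j$ and let $m_i=m_i(q)$ be the number of parts equal to $i$. Let $\Xi^q$ be the sum of all $\sigma\in\mathfrak S_n$ whose descents (the $i\in[1,n-1]$ with $(i)\sigma>(i+1)\sigma$) all lie in $\{q_1^+,\dots,q_k^+\}$. Let $\omega^q$ be the product over $j$ of the elements $\omega_{q_j}$ written on the letters $q_{j-1}^++1,\dots,q_j^+$, and let $\omega_q=\omega^q\,\Xi^q$ and $\mathrm{Lie}_F(q)=\omega_qF\mathfrak S_n$. For a module $M$ of a group $G$, the module $M^{\wr m}$ is $M^{\otimes m}$ with $G\wr\mathfrak S_m$ acting by $(v_1\otimes\cdots\otimes v_m)(\tau;g_1,\dots,g_m)=v_{(1)\tau^{-1}}g_1\otimes\cdots\otimes v_{(m)\tau^{-1}}g_m$.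 Let $C_i\le\mathfrak S_i$ be generated by a cycle of length $i$. The groups $\prod_{i=1}^n(C_i\wr\mathfrak S_{m_i})\le\prod_{i=1}^n(\mathfrak S_i\wr\mathfrak S_{m_i})$ are viewed as subgroups of $\mathfrak S_n$ by identifying $\{1,\dots,n\}$, in any way, with the disjoint union over $i$ of $m_i$ blocks of $i$ letters. Write $(q,p)=1$ if $p$ divides no part of $q$ (which always holds if $p=0$). (1) For every $n$ and every composition $q$ of $n$ with $(q,p)=1$ there is an isomorphism of $F\mathfrak S_n$-modules $$\mathrm{Lie}_F(q)\cong \mathrm{ind}^{\mathfrak S_n}_{\prod_{i=1}^n(\mathfrak S_i\wr\mathfrak S_{m_i})}\bigl(\mathrm{Lie}_F(1)^{\wr m_1}\boxtimes\cdots\boxtimes\mathrm{Lie}_F(n)^{\wr m_n}\bigr).$$ (2) There are one-dimensional $FC_i$-modules $F_{\delta_i}$, depending only on $F$ and $i$, on which the chosen generator of $C_i$ acts as a primitive $i$th root of unity $\delta_i$ whenever $p\nmid i$ and $F$ contains such a root, with the following property: for every $n$ and every composition $q$ of $n$ with $(q,p)=1$ such that $F$ contains a primitive $i$th root of unity for each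 $i$ with $m_i>0$, $$\mathrm{Lie}_F(q)\cong \mathrm{ind}^{\mathfrak S_n}_{\prod_{i=1}^n(C_i\wr\mathfrak S_{m_i})}F_\delta,\qquad F_\delta=F_{\delta_1}^{\wr m_1}\boxtimes\cdots\boxtimes F_{\delta_n}^{\wr m_n}.$$ -/

import Mathlib

/-!
Conventions.  Permutations of `{1, …, n}` are `Equiv.Perm (Fin n)` (letters shifted by one), and
`σ` is read as the word `σ 0, σ 1, …, σ (n - 1)`.

The source composes permutations from left to right and uses right modules.  Mathlib composes from
right to left, so the group of the source is the opposite of `Equiv.Perm (Fin n)`; a right module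
over the former is literally a left module over the latter, and a right ideal `ω A` is the left
ideal generated by `ω`.  Hence all products of the source are written below with
their factors in the reverse order, and all modules are (left) representations.
-/

open scoped TensorProduct

namespace HigherLie

noncomputable section

universe u

/-! ### Wreath products, wreath powers of modules, outer tensor products -/

/-- The wreath product `G ≀ S_m`: pairs `(g, τ)` with `g : Fin m → G`, `τ ∈ S_m`, and
`(g, τ) (g', τ') = (j ↦ g j * g' (τ⁻¹ j), τ τ')`. -/
abbrev Wreath (G : Type) [Group G] (m : ℕ) : Type :=
  (Fin m → G) ⋊[mulAutArrow] Equiv.Perm (Fin m)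

theorem wreath_mul_left {G : Type} [Group G] {m : ℕ} (w w' : Wreath G m) (j : Fin m) :
    (w * w').left j = w.left j * w'.left (w.right⁻¹ j) := rfl

/-- The wreath power `V^{≀ m}` of a representation of `G`: the space `V^{⊗ m}` with
`(g, τ) (v_1 ⊗ ⋯ ⊗ v_m) = g_1 v_{τ⁻¹ 1} ⊗ ⋯ ⊗ g_m v_{τ⁻¹ m}`. -/
def wreathPower {F : Type u} [Field F] {G : Type} [Group G] {V : Type u} [AddCommGroup V]
    [Module F V] (ρ : Representation F G V) (m : ℕ) :
    Representation F (Wreath G m) (⨂[F] _ : Fin m, V) where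
  toFun w := PiTensorProduct.map (fun j => ρ (w.left j)) ∘ₗ
    (PiTensorProduct.reindex F (fun _ => V) w.right).toLinearMap
  map_one' := by
    ext v
    simp
    rfl
  map_mul' w w' := by
    ext v
    simp [wreath_mul_left, -SemidirectProduct.mul_left]
    rfl

/-- The outer tensor product of a finite family of representations of groups `H i`, as a
representation of `∏ H i`. -/
def outerTensor {F : Type u} [Field F] {ι : Type} {H : ι → Type} [∀ i, Group (H i)]
    {V : ι → Type u} [∀ i, AddCommGroup (V i)] [∀ i, Module F (V i)]
    (ρ : ∀ i, Representation F (H i) (V i)) :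
    Representation F (∀ i, H i) (⨂[F] i, V i) :=
  PiTensorProduct.mapMonoidHom.comp
    (MonoidHom.pi fun i => (ρ i).comp (Pi.evalMonoidHom H i))

/-- If `G` acts on `X` through `φ`, then `G ≀ S_m` acts on `m` copies of `X` (the blocks) by
`(g, τ) (j, x) = (τ j, g (τ j) x)`. -/
def wreathPerm {G : Type} [Group G] {X : Type} (φ : G →* Equiv.Perm X) (m : ℕ) :
    Wreath G m →* Equiv.Perm (Fin m × X) where
  toFun w :=
    { toFun := fun y => (w.right y.1, φ (w.left (w.right y.1)) y.2)
      invFun := fun y => (w.right⁻¹ y.1, (φ (w.left y.1))⁻¹ y.2)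
      left_inv := fun y => by simp
      right_inv := fun y => by simp }
  map_one' := by
    ext y <;> simp
  map_mul' w w' := by
    ext y <;> simp [wreath_mul_left, -SemidirectProduct.mul_left]

/-- A linear character `χ` as a one-dimensional module `F_χ`. -/
def oneDim {F : Type u} [Field F] {G : Type} [Group G] (χ : G →* F) : Representation F G F where
  toFun g := χ g • LinearMap.id
  map_one' := by
    ext
    simp
  map_mul' g h := by
    ext
    simp [mul_comm]

/-! ### Higher Lie modules -/

/-- The Dynkin–Specht–Wever element `ω_n = (1 - c_n) (1 - c_{n-1}) ⋯ (1 - c_2)` (product of the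
source, hence reversed here), where `c_k` is the descending cycle `k ↦ k-1 ↦ ⋯ ↦ 1 ↦ k`;
`Fin.cycleRange i` is the ascending cycle on the first `i + 1` letters. -/
def omega (F : Type u) [Field F] (n : ℕ) : MonoidAlgebra F (Equiv.Perm (Fin n)) :=
  (((List.finRange n).filter fun i : Fin n => i.val ≠ 0).map fun i =>
    1 - MonoidAlgebra.of F (Equiv.Perm (Fin n)) (Fin.cycleRange i)⁻¹).prod

/-- `σ` has a descent at (the one-based position) `i`. -/
def IsDescent {n : ℕ} (σ : Equiv.Perm (Fin n)) (i : ℕ) : Prop :=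
  ∃ (_ : 0 < i) (h : i < n), σ ⟨i, h⟩ < σ ⟨i - 1, by omega⟩

open Classical in
/-- Solomon's descent element `Ξ^q`: the sum of all `σ` whose descents are partial sums
`q_1 + ⋯ + q_j` with `1 ≤ j ≤ ℓ(q)`. -/
def solomon (F : Type u) [Field F] {n : ℕ} (q : Composition n) :
    MonoidAlgebra F (Equiv.Perm (Fin n)) :=
  ∑ σ : Equiv.Perm (Fin n) with
      ∀ i, IsDescent σ i → ∃ j, 1 ≤ j ∧ j ≤ q.length ∧ i = q.sizeUpTo j,
    MonoidAlgebra.of F (Equiv.Perm (Fin n)) σ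

/-- `ω^q`: the product of the elements `ω_{q_j}`, the `j`-th one written on the `j`-th of the
consecutive intervals of lengths `q_1, q_2, …` (the factors commute). -/
def omegaUpper (F : Type u) [Field F] {n : ℕ} (q : Composition n) :
    MonoidAlgebra F (Equiv.Perm (Fin n)) :=
  (List.ofFn fun j : Fin q.length =>
    MonoidAlgebra.mapDomainRingHom F
      (Equiv.Perm.viaEmbeddingHom (q.embedding j).toEmbedding)
      (omega F (q.blocksFun j))).prod

/-- The higher Lie element `ω_q = ω^q Ξ^q` (product of the source, hence reversed here). -/
def omegaLower (F : Type u) [Field F] {n : ℕ} (q : Composition n) :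
    MonoidAlgebra F (Equiv.Perm (Fin n)) :=
  solomon F q * omegaUpper F q

/-- The space of the module generated by `x` inside the group algebra. -/
abbrev Generated {F : Type u} [Field F] {n : ℕ}
    (x : MonoidAlgebra F (Equiv.Perm (Fin n))) : Type u :=
  ↥(Ideal.span {x} : Ideal (MonoidAlgebra F (Equiv.Perm (Fin n))))

/-- The module generated by `x` inside the group algebra of the symmetric group. -/
abbrev generatedRep {F : Type u} [Field F] {n : ℕ}
    (x : MonoidAlgebra F (Equiv.Perm (Fin n))) :
    Representation F (Equiv.Perm (Fin n)) (Generated x) :=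
  Representation.ofModule' (Generated x)

/-- The Lie module `Lie_F(i)`, generated by `ω_i`. -/
abbrev lieModule (F : Type u) [Field F] (i : ℕ) :
    Representation F (Equiv.Perm (Fin i)) (Generated (omega F i)) :=
  generatedRep (omega F i)

/-- The higher Lie module `Lie_F(q)`, generated by `ω_q`. -/
abbrev higherLie (F : Type u) [Field F] {n : ℕ} (q : Composition n) :
    Representation F (Equiv.Perm (Fin n)) (Generated (omegaLower F q)) :=
  generatedRep (omegaLower F q)

/-! ### The subgroups `∏ (S_i ≀ S_{m_i})`, `∏ (C_i ≀ S_{m_i})` and induction from them -/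

/-- The number `m_i(q)` of parts of `q` equal to `i`. -/
abbrev mult {n : ℕ} (q : Composition n) (i : ℕ) : ℕ := q.blocks.count i

/-- The disjoint union over `1 ≤ i ≤ n` of `m_i(q)` blocks of `i` letters. -/
abbrev Letters {n : ℕ} (q : Composition n) : Type :=
  Σ i : Finset.Icc 1 n, Fin (mult q i) × Fin i

/-- The product of the wreath products `G_i ≀ S_{m_i}` over `1 ≤ i ≤ n`. -/
abbrev WreathProd (G : ℕ → Type) [∀ i, Group (G i)] {n : ℕ} (q : Composition n) : Type :=
  ∀ i : Finset.Icc 1 n, Wreath (G i) (mult q i)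

/-- The homomorphism `∏ (G_i ≀ S_{m_i}) → S_n` for groups `G_i` acting on `i` letters, after an
identification `e` of the letters of the blocks with `Fin n`. -/
def wreathProdPerm {G : ℕ → Type} [∀ i, Group (G i)] (φ : ∀ i, G i →* Equiv.Perm (Fin i))
    {n : ℕ} (q : Composition n) (e : Letters q ≃ Fin n) :
    WreathProd G q →* Equiv.Perm (Fin n) :=
  e.permCongrHom.toMonoidHom.comp
    ((Equiv.Perm.sigmaCongrRightHom fun i : Finset.Icc 1 n => Fin (mult q i) × Fin i).comp
      (MonoidHom.pi fun i =>
        (wreathPerm (φ i) (mult q i)).comp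
          (Pi.evalMonoidHom (fun i : Finset.Icc 1 n => Wreath (G i) (mult q i)) i)))

/-- The module `V_1^{≀ m_1} ⊠ ⋯ ⊠ V_n^{≀ m_n}` of `∏ (G_i ≀ S_{m_i})`. -/
abbrev wreathOuter {F : Type u} [Field F] {G : ℕ → Type} [∀ i, Group (G i)]
    {V : ℕ → Type u} [∀ i, AddCommGroup (V i)] [∀ i, Module F (V i)]
    (ρ : ∀ i, Representation F (G i) (V i)) {n : ℕ} (q : Composition n) :
    Representation F (WreathProd G q)
      (⨂[F] i : Finset.Icc 1 n, ⨂[F] _ : Fin (mult q i), V i) :=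
  outerTensor fun i : Finset.Icc 1 n => wreathPower (ρ i) (mult q i)

/-- The module induced from `∏ (G_i ≀ S_{m_i})` to `S_n` of the outer tensor product
`V_1^{≀ m_1} ⊠ ⋯ ⊠ V_n^{≀ m_n}`. -/
abbrev inducedWreath {F : Type u} [Field F] {G : ℕ → Type} [∀ i, Group (G i)]
    (φ : ∀ i, G i →* Equiv.Perm (Fin i))
    {V : ℕ → Type u} [∀ i, AddCommGroup (V i)] [∀ i, Module F (V i)]
    (ρ : ∀ i, Representation F (G i) (V i)) {n : ℕ} (q : Composition n)
    (e : Letters q ≃ Fin n) :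
    Representation F (Equiv.Perm (Fin n))
      (Representation.IndV (wreathProdPerm φ q e) (wreathOuter ρ q)) :=
  Representation.ind (wreathProdPerm φ q e) (wreathOuter ρ q)

/-- The cyclic subgroup `C_i` of `S_i` generated by a cycle of length `i`. -/
abbrev cyc (i : ℕ) : Subgroup (Equiv.Perm (Fin i)) := Subgroup.zpowers (finRotate i)

/-- The chosen generator of `C_i`. -/
def cycGen (i : ℕ) : cyc i := ⟨finRotate i, Subgroup.mem_zpowers _⟩

/-- The blocks have `n` letters altogether, so identifications as above exist. -/
theorem nonempty_letters_equiv {n : ℕ} (q : Composition n) : Nonempty (Letters q ≃ Fin n) := by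
  classical
  refine ⟨Fintype.equivFinOfCardEq ?_⟩
  have h1 : Fintype.card (Letters q) = ∑ i : Finset.Icc 1 n, mult q i * (i : ℕ) := by
    simp [Letters, Fintype.card_sigma]
  rw [h1, Finset.sum_coe_sort (Finset.Icc 1 n) fun i => mult q i * i]
  have h2 := Finset.sum_list_count_of_subset q.blocks (Finset.Icc 1 n) (fun i hi => by
    have hi' := List.mem_toFinset.1 hi
    exact Finset.mem_Icc.2 ⟨q.one_le_blocks hi', q.blocks_le hi'⟩)
  rw [q.blocks_sum] at h2
  simpa using h2.symm

/-- If the groups `G_i` act faithfully, then `∏ (G_i ≀ S_{m_i}) → S_n` is injective, that is,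
the product is a subgroup of `S_n`. -/
theorem wreathProdPerm_injective {G : ℕ → Type} [∀ i, Group (G i)]
    (φ : ∀ i, G i →* Equiv.Perm (Fin i)) (hφ : ∀ i, Function.Injective (φ i))
    {n : ℕ} (q : Composition n) (e : Letters q ≃ Fin n) :
    Function.Injective (wreathProdPerm φ q e) := by
  intro w w' h
  have h' := Equiv.Perm.sigmaCongrRightHom_injective (e.permCongrHom.injective h)
  funext i
  have hi := congrFun h' i
  have key : ∀ y, wreathPerm (φ i) (mult q i) (w i) y = wreathPerm (φ i) (mult q i) (w' i) y :=
    fun y => congrArg (fun f : Equiv.Perm _ => f y) hi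
  have hpos : 0 < (i : ℕ) := (Finset.mem_Icc.1 i.2).1
  have hr : (w i).right = (w' i).right :=
    Equiv.ext fun j => congrArg Prod.fst (key (j, ⟨0, hpos⟩))
  refine SemidirectProduct.ext (funext fun j => hφ i (Equiv.ext fun x => ?_)) hr
  have hx := congrArg Prod.snd (key ((w i).right⁻¹ j, x))
  simpa [wreathPerm, ← hr] using hx

end

end HigherLie

/-! All modules are realised inside A = F[S_n]: `IsModel ρ x` says that ρ is isomorphic to the left
ideal generated by x. Such presentations pass through outer tensor products, wreath powers and
induction from subgroups (`isModel_outerTensor`, `isModel_wreathPower`, `isModel_ind`). If V_i is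
presented by x_i, the module induced from the product of the G_i ≀ S_{m_i} is therefore presented by
X B, where X is the product of the x_i written on all blocks and B is the sum of the permutations of
blocks of equal length (`isModel_inducedWreath`). Products of this kind commute with B.

For (1), take X = ω^q and let Ξ be the Solomon element, so that ω_q = Ξ ω^q in the order used here.
Three facts suffice. A sign-reversing involution gives ω^q Ξ = ω^q B (`omegaUpper_mul_solomon`). The
support of Ξ is a union of left cosets of the group summed by B, so Ξ = r B for some r
(`solomon_mem_span`). Finally ω^q ω^q = c ω^q with c the product of the parts of q, nonzero in F
(`blockProd_omega_mul_self`, from `omega_mul_omega`). Hence ω^q ω_q = ω^q B ω^q = c ω^q B and ω_q =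
r B ω^q = r ω^q B: the two left ideals coincide.

For (2), ω_n D = ∏ (v_i - u_i) ω_n whenever D is a sum of permutations weighted by u_i at descents
and v_i at ascents (`omega_mul_descentSum`). Choosing the weights ζ^maj gives Klyachko's element, on
which C_n acts by δ_n and which ω_n does not annihilate. Together with a dimension count this makes
the ideals of ω_n and of the character sum of C_n isomorphic through explicit right multiplications
(`exists_omega_cycSum_inverse`). These are applied on all blocks at once
(`IsModel.blockProd_congr`), which reduces (2) to (1). -/

open scoped TensorProduct

namespace HigherLie

noncomputable section

universe u

open MonoidAlgebra Module

/-! ### Group algebras of direct products -/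

section Outer

variable {F : Type u} [Field F] {ι : Type} [Fintype ι] {H : ι → Type} [∀ i, Group (H i)]

/-- The tensor product of group algebras is the group algebra of the product. -/
def tensorAlgebraEquiv :
    (⨂[F] i, MonoidAlgebra F (H i)) ≃ₗ[F] MonoidAlgebra F (∀ i, H i) :=
  (Basis.piTensorProduct fun i => MonoidAlgebra.basis (H i) F).equiv
    (MonoidAlgebra.basis (∀ i, H i) F) (Equiv.refl _)

/-- The outer product of elements of group algebras. -/
def piProd : MultilinearMap F (fun i => MonoidAlgebra F (H i)) (MonoidAlgebra F (∀ i, H i)) :=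
  tensorAlgebraEquiv.toLinearMap.compMultilinearMap (PiTensorProduct.tprod F)

theorem piProd_of (g : ∀ i, H i) :
    piProd (fun i => of F (H i) (g i)) = of F (∀ i, H i) g := by
  have h := Basis.piTensorProduct_apply (R := F) (fun i => MonoidAlgebra.basis (H i) F) g
  simp only [MonoidAlgebra.basis_apply] at h
  simp only [piProd, LinearMap.compMultilinearMap_apply, of_apply, ← h, LinearEquiv.coe_coe,
    tensorAlgebraEquiv, Basis.equiv_apply, Equiv.refl_apply, MonoidAlgebra.basis_apply]

theorem piProd_mul (x y : ∀ i, MonoidAlgebra F (H i)) :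
    piProd (x * y) = piProd x * piProd y := by
  -- Both sides are multilinear in each argument. Here y consists of group elements and x is reduced
  -- to a basis; afterwards y is reduced for arbitrary x.
  have h1 : ∀ (h : ∀ i, H i) (x : ∀ i, MonoidAlgebra F (H i)),
      piProd (fun i => x i * of F (H i) (h i)) = piProd x * of F (∀ i, H i) h := by
    intro h
    refine fun x => congrArg (fun f => f x) (Basis.ext_multilinear
      (f := piProd.compLinearMap fun i => LinearMap.mulRight F (of F (H i) (h i)))
      (g := (LinearMap.mulRight F (of F (∀ i, H i) h)).compMultilinearMap piProd)
      (fun i => MonoidAlgebra.basis (H i) F) fun g => ?_)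
    have e1 := piProd_of (F := F) g
    have e2 := piProd_of (F := F) (g * h)
    simp only [MonoidAlgebra.basis_apply, MultilinearMap.compLinearMap_apply,
      LinearMap.mulRight_apply, LinearMap.compMultilinearMap_apply, Pi.mul_apply, map_mul,
      of_apply] at e1 e2 ⊢
    rw [e1, e2]
  refine congrArg (fun f => f y) (Basis.ext_multilinear
      (f := piProd.compLinearMap fun i => LinearMap.mulLeft F (x i))
      (g := (LinearMap.mulLeft F (piProd x)).compMultilinearMap piProd)
      (fun i => MonoidAlgebra.basis (H i) F) fun g => ?_)
  have e1 := piProd_of (F := F) g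
  have e2 := h1 g x
  simp only [MonoidAlgebra.basis_apply, MultilinearMap.compLinearMap_apply,
    LinearMap.mulLeft_apply, LinearMap.compMultilinearMap_apply, of_apply] at e1 e2 ⊢
  rw [e1, e2]

end Outer

/-! ### Representations as left ideals of group algebras -/

section Model

variable {F : Type u} [Field F] {G : Type} [Group G] {V : Type u} [AddCommGroup V] [Module F V]

/-- The representation `ρ` is isomorphic to the left ideal generated by `x`. -/
def IsModel (ρ : Representation F G V) (x : MonoidAlgebra F G) : Prop :=
  ∃ ι : V →ₗ[F] MonoidAlgebra F G, Function.Injective ι ∧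
    (∀ g v, ι (ρ g v) = of F G g * ι v) ∧ ∀ y, y ∈ Ideal.span {x} ↔ ∃ v, ι v = y

theorem asAlgebraHom_of_equivariant {ρ : Representation F G V} {ι : V →ₗ[F] MonoidAlgebra F G}
    (h : ∀ g v, ι (ρ g v) = of F G g * ι v) (a : MonoidAlgebra F G) (v : V) :
    ι (ρ.asAlgebraHom a v) = a * ι v := by
  induction a using MonoidAlgebra.induction_linear with
  | zero => simp
  | add f g hf hg => simp [hf, hg, add_mul]
  | single g r =>
    rw [Representation.asAlgebraHom_single, LinearMap.smul_apply, map_smul, h, ← smul_mul_assoc,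
      smul_of]

/-- Equivariance and membership in the ideal are linear conditions, so they can be tested on pure
tensors or on the generators of an induced module. The image is then a left ideal containing x,
hence everything. -/
theorem IsModel.mk {ρ : Representation F G V} {x : MonoidAlgebra F G}
    (ι : V →ₗ[F] MonoidAlgebra F G) (hι : Function.Injective ι) {S : Set V}
    (hS : Submodule.span F S = ⊤)
    (h : ∀ g, ∀ v ∈ S, ι (ρ g v) = of F G g * ι v) (hx : ∃ v, ι v = x)
    (hs : ∀ v ∈ S, ι v ∈ Ideal.span {x}) : IsModel ρ x := by
  have h' : ∀ g v, ι (ρ g v) = of F G g * ι v := fun g v => by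
    have hv : v ∈ Submodule.span F S := hS ▸ Submodule.mem_top
    induction hv using Submodule.span_induction with
    | mem v hv => exact h g v hv
    | zero => simp
    | add v w _ _ hv hw => simp only [map_add, hv, hw, mul_add]
    | smul r v _ hv => simp only [map_smul, hv, mul_smul_comm]
  refine ⟨ι, hι, h', fun y => ⟨fun hy => ?_, ?_⟩⟩
  · obtain ⟨a, rfl⟩ := Ideal.mem_span_singleton'.1 hy
    obtain ⟨v, rfl⟩ := hx
    exact ⟨_, asAlgebraHom_of_equivariant h' a v⟩
  · rintro ⟨v, rfl⟩
    have hv : v ∈ Submodule.span F S := hS ▸ Submodule.mem_top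
    induction hv using Submodule.span_induction with
    | mem v hv => exact hs v hv
    | zero => simp
    | add v w _ _ hv hw => simpa only [map_add] using add_mem hv hw
    | smul r v _ hv => simpa only [map_smul] using Submodule.smul_of_tower_mem _ r hv

/-- The left ideals generated by two elements related by mutually inverse right multiplications
are isomorphic. -/
theorem IsModel.congr {ρ : Representation F G V} {x y u v : MonoidAlgebra F G} (hρ : IsModel ρ x)
    (hxu : x * u ∈ Ideal.span {y}) (hyv : y * v ∈ Ideal.span {x}) (hx : x * u * v = x)
    (hy : y * v * u = y) : IsModel ρ y := by
  obtain ⟨ι, hι, h, hs⟩ := hρ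
  have hr : ∀ w, ι w * u * v = ι w := fun w => by
    obtain ⟨a, ha⟩ := Ideal.mem_span_singleton'.1 ((hs _).2 ⟨w, rfl⟩)
    rw [← ha, mul_assoc, mul_assoc, ← mul_assoc x, hx]
  refine IsModel.mk (LinearMap.mulRight F u ∘ₗ ι) (fun w w' hw => hι ?_) Submodule.span_univ
    (fun g w _ => ?_) ?_ fun w _ => ?_
  · rw [← hr w, ← hr w']
    exact congrArg (· * v) hw
  · simp [h, mul_assoc]
  · obtain ⟨w, hw⟩ := (hs _).1 hyv
    exact ⟨w, by simp [hw, hy]⟩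
  · obtain ⟨a, ha⟩ := Ideal.mem_span_singleton'.1 ((hs _).2 ⟨w, rfl⟩)
    simp only [LinearMap.comp_apply, LinearMap.mulRight_apply, ← ha, mul_assoc]
    exact Ideal.mul_mem_left _ _ hxu

theorem isModel_generatedRep {n : ℕ} (x : MonoidAlgebra F (Equiv.Perm (Fin n))) :
    IsModel (generatedRep x) x := by
  refine IsModel.mk ((Ideal.span {x}).subtype.restrictScalars F) Subtype.val_injective
    Submodule.span_univ (fun g v _ => rfl) ⟨⟨x, Ideal.mem_span_singleton_self x⟩, rfl⟩
    fun v _ => v.2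

theorem IsModel.nonempty_equiv {n : ℕ} {ρ : Representation F (Equiv.Perm (Fin n)) V}
    {x : MonoidAlgebra F (Equiv.Perm (Fin n))} (h : IsModel ρ x) :
    Nonempty ((generatedRep x).Equiv ρ) := by
  obtain ⟨ι, hι, h, hs⟩ := h
  let f : V →ₗ[F] Generated x :=
    { toFun := fun v => ⟨ι v, (hs _).2 ⟨v, rfl⟩⟩
      map_add' := fun v w => Subtype.ext (map_add ι v w)
      map_smul' := fun r v => Subtype.ext (map_smul ι r v) }
  have hf : Function.Bijective f :=
    ⟨fun v w hvw => hι (congrArg Subtype.val hvw), fun y => by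
      obtain ⟨v, hv⟩ := (hs _).1 y.2
      exact ⟨v, Subtype.ext hv⟩⟩
  refine ⟨(Representation.Equiv.mk (LinearEquiv.ofBijective f hf) fun g => ?_).symm⟩
  exact LinearMap.ext fun v => Subtype.ext (h g v)

theorem outerTensor_tprod {ι : Type} {H : ι → Type} [∀ i, Group (H i)]
    {V : ι → Type u} [∀ i, AddCommGroup (V i)] [∀ i, Module F (V i)]
    (ρ : ∀ i, Representation F (H i) (V i)) (g : ∀ i, H i) (v : ∀ i, V i) :
    outerTensor ρ g (PiTensorProduct.tprod F v) =
      PiTensorProduct.tprod F fun i => ρ i (g i) (v i) := by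
  simp only [outerTensor, MonoidHom.comp_apply]
  exact PiTensorProduct.map_tprod _ _

/-- A tensor product of embeddings into group algebras, as an embedding into the group algebra of
the product. -/
theorem exists_tensor_embedding {ι : Type} [Fintype ι] {H : ι → Type} [∀ i, Group (H i)]
    {V : ι → Type u} [∀ i, AddCommGroup (V i)] [∀ i, Module F (V i)]
    (j : ∀ i, V i →ₗ[F] MonoidAlgebra F (H i)) (hj : ∀ i, Function.Injective (j i)) :
    ∃ J : (⨂[F] i, V i) →ₗ[F] MonoidAlgebra F (∀ i, H i), Function.Injective J ∧
      ∀ v, J (PiTensorProduct.tprod F v) = piProd fun i => j i (v i) := by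
  have hinj : Function.Injective (PiTensorProduct.map j) := by
    choose r hr using fun i => (j i).exists_leftInverse_of_injective (LinearMap.ker_eq_bot.2 (hj i))
    refine Function.LeftInverse.injective (g := PiTensorProduct.map r) fun t => ?_
    rw [← LinearMap.comp_apply, ← PiTensorProduct.map_comp]
    simp [hr]
  refine ⟨tensorAlgebraEquiv.toLinearMap ∘ₗ PiTensorProduct.map j,
    tensorAlgebraEquiv.injective.comp hinj, fun v => ?_⟩
  rw [LinearMap.comp_apply, PiTensorProduct.map_tprod]
  rfl

/-- Outer tensor products of left ideals. -/
theorem isModel_outerTensor {ι : Type} [Fintype ι] {H : ι → Type} [∀ i, Group (H i)]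
    {V : ι → Type u} [∀ i, AddCommGroup (V i)] [∀ i, Module F (V i)]
    {ρ : ∀ i, Representation F (H i) (V i)} {x : ∀ i, MonoidAlgebra F (H i)}
    (h : ∀ i, IsModel (ρ i) (x i)) : IsModel (outerTensor ρ) (piProd x) := by
  choose j hj he hs using h
  obtain ⟨J, hJ, hJt⟩ := exists_tensor_embedding j hj
  refine IsModel.mk J hJ PiTensorProduct.span_tprod_eq_top ?_ ?_ ?_
  · rintro g _ ⟨v, rfl⟩
    rw [outerTensor_tprod, hJt, hJt, ← piProd_of, ← piProd_mul]
    simp only [he]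
    rfl
  · choose v hv using fun i => (hs i (x i)).1 (Ideal.mem_span_singleton_self _)
    exact ⟨PiTensorProduct.tprod F v, by simp only [hJt, hv]⟩
  · rintro _ ⟨v, rfl⟩
    choose a ha using fun i => Ideal.mem_span_singleton'.1 ((hs i _).2 ⟨v i, rfl⟩)
    refine Ideal.mem_span_singleton'.2 ⟨piProd a, ?_⟩
    rw [← piProd_mul, hJt]
    exact congrArg piProd (funext ha)

/-- The sum of the block permutations in the group algebra of a wreath product. -/
def blockSum (F : Type u) [Field F] (G : Type) [Group G] (m : ℕ) : MonoidAlgebra F (Wreath G m) :=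
  ∑ τ : Equiv.Perm (Fin m), of F (Wreath G m) (SemidirectProduct.inr τ)

theorem inr_mul_blockSum (m : ℕ) (τ : Equiv.Perm (Fin m)) :
    of F (Wreath G m) (SemidirectProduct.inr τ) * blockSum F G m = blockSum F G m := by
  rw [blockSum, Finset.mul_sum]
  refine Fintype.sum_equiv (Equiv.mulLeft τ) _ _ fun σ => ?_
  rw [← map_mul, ← map_mul]
  rfl

/-- The map of group algebras `F[G^m] → F[G ≀ S_m]`. -/
abbrev baseHom (F : Type u) [Field F] (G : Type) [Group G] (m : ℕ) :
    MonoidAlgebra F (Fin m → G) →+* MonoidAlgebra F (Wreath G m) :=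
  mapDomainRingHom F (SemidirectProduct.inl : (Fin m → G) →* Wreath G m)

theorem inr_mul_baseHom_piProd (m : ℕ) (τ : Equiv.Perm (Fin m)) (x : Fin m → MonoidAlgebra F G) :
    of F (Wreath G m) (SemidirectProduct.inr τ) * baseHom F G m (piProd x) =
      baseHom F G m (piProd fun j => x (τ⁻¹ j)) *
        of F (Wreath G m) (SemidirectProduct.inr τ) := by
  let f : MonoidAlgebra F (Fin m → G) →ₗ[F] MonoidAlgebra F (Wreath G m) :=
    mapDomainLinearMap F F SemidirectProduct.inl
  refine congrArg (fun f => f x) (Basis.ext_multilinear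
    (f := (LinearMap.mulLeft F (of F (Wreath G m) (SemidirectProduct.inr τ)) ∘ₗ
      f).compMultilinearMap piProd)
    (g := (LinearMap.mulRight F (of F (Wreath G m) (SemidirectProduct.inr τ)) ∘ₗ
      f).compMultilinearMap (piProd.domDomCongr τ⁻¹))
    (fun _ => MonoidAlgebra.basis G F) fun g => ?_)
  have e1 := piProd_of (F := F) g
  have e2 := piProd_of (F := F) fun j => g (τ⁻¹ j)
  simp only [MonoidAlgebra.basis_apply, LinearMap.compMultilinearMap_apply,
    MultilinearMap.domDomCongr_apply, LinearMap.comp_apply, LinearMap.mulLeft_apply,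
    LinearMap.mulRight_apply, of_apply] at e1 e2 ⊢
  rw [e1, e2]
  simp only [f, mapDomainLinearMap_single, single_mul_single]
  congr 1
  refine SemidirectProduct.ext ?_ ?_
  · simp
    rfl
  · simp

/-- Elements of the base group G^m arise only from the summand τ = 1 of the block sum. So
multiplication by the block sum loses no information about x, which makes the embedding of the
wreath power injective. -/
theorem coeff_baseHom_mul_blockSum (m : ℕ) (x : MonoidAlgebra F (Fin m → G)) (g : Fin m → G) :
    (baseHom F G m x * blockSum F G m).coeff (SemidirectProduct.inl g) = x.coeff g := by
  rw [blockSum, Finset.mul_sum, coeff_sum, Finsupp.finsetSum_apply, Finset.sum_eq_single 1]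
  · rw [map_one, map_one, mul_one]
    exact Finsupp.mapDomain_apply SemidirectProduct.inl_injective _ _
  · intro τ _ hτ
    rw [of_apply, coeff_mul_single_apply, mul_one]
    refine Finsupp.mapDomain_of_notMem_range _ _ ?_
    rintro ⟨g', hg'⟩
    have h := congrArg SemidirectProduct.right hg'
    simp at h
    exact hτ h
  · simp

theorem baseHom_mul_blockSum_injective (m : ℕ) :
    Function.Injective fun x => baseHom F G m x * blockSum F G m := by
  intro x y h
  refine coeff_injective (Finsupp.ext fun g => ?_)
  rw [← coeff_baseHom_mul_blockSum, ← coeff_baseHom_mul_blockSum]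
  exact congrArg (fun z : MonoidAlgebra F (Wreath G m) => z.coeff (SemidirectProduct.inl g)) h

theorem wreathPower_tprod (ρ : Representation F G V) {m : ℕ} (w : Wreath G m) (v : Fin m → V) :
    wreathPower ρ m w (PiTensorProduct.tprod F v) =
      PiTensorProduct.tprod F fun j => ρ (w.left j) (v (w.right⁻¹ j)) := by
  change PiTensorProduct.map _ (PiTensorProduct.reindex F (fun _ => V) w.right
    (PiTensorProduct.tprod F v)) = _
  rw [PiTensorProduct.reindex_tprod, PiTensorProduct.map_tprod]
  rfl

/-- Wreath powers of left ideals. -/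
theorem isModel_wreathPower {ρ : Representation F G V} {x : MonoidAlgebra F G} (h : IsModel ρ x)
    (m : ℕ) : IsModel (wreathPower ρ m) (baseHom F G m (piProd fun _ => x) * blockSum F G m) := by
  obtain ⟨j, hj, he, hs⟩ := h
  obtain ⟨J, hJ, hJt⟩ := exists_tensor_embedding (fun _ : Fin m => j) fun _ => hj
  have hJr : ∀ (r : F) (y : MonoidAlgebra F (Fin m → G)),
      baseHom F G m (r • y) = r • baseHom F G m y := fun r y => mapDomain_smul _ _ _
  let ι : (⨂[F] _ : Fin m, V) →ₗ[F] MonoidAlgebra F (Wreath G m) :=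
    { toFun := fun t => baseHom F G m (J t) * blockSum F G m
      map_add' := fun s t => by rw [map_add, map_add, add_mul]
      map_smul' := fun r t => by rw [map_smul, hJr, smul_mul_assoc]; rfl }
  have hι : ∀ t, ι t = baseHom F G m (J t) * blockSum F G m := fun _ => rfl
  refine IsModel.mk ι ((baseHom_mul_blockSum_injective m).comp hJ)
    PiTensorProduct.span_tprod_eq_top ?_ ?_ ?_
  · rintro w _ ⟨v, rfl⟩
    rw [wreathPower_tprod, hι, hι, hJt, hJt]
    -- After this factorisation of w, the permutation part moves past the base element, permuting
    -- its tensor factors, and is absorbed by the block sum.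
    have hw : of F (Wreath G m) w = baseHom F G m (piProd fun i => of F G (w.left i)) *
        of F (Wreath G m) (SemidirectProduct.inr w.right) := by
      rw [piProd_of, mapDomainRingHom_apply, of_apply, of_apply, mapDomain_single, ← of_apply,
        ← of_apply, ← map_mul, SemidirectProduct.inl_left_mul_inr_right]
    rw [hw, mul_assoc, ← mul_assoc (of F (Wreath G m) _), inr_mul_baseHom_piProd, mul_assoc,
      inr_mul_blockSum, ← mul_assoc, ← map_mul, ← piProd_mul]
    simp only [he]
    rfl
  · obtain ⟨v, hv⟩ := (hs x).1 (Ideal.mem_span_singleton_self _)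
    exact ⟨PiTensorProduct.tprod F fun _ => v, by simp only [hι, hJt, hv]⟩
  · rintro _ ⟨v, rfl⟩
    choose a ha using fun i => Ideal.mem_span_singleton'.1 ((hs _).2 ⟨v i, rfl⟩)
    refine Ideal.mem_span_singleton'.2 ⟨baseHom F G m (piProd a), ?_⟩
    rw [← mul_assoc, ← map_mul, ← piProd_mul, hι, hJt]
    exact congrArg (fun y => baseHom F G m (piProd y) * blockSum F G m) (funext ha)

/-- The element of the group algebra belonging to a linear character. -/
def charSum [Fintype G] (χ : G →* F) : MonoidAlgebra F G :=
  ∑ g : G, χ g⁻¹ • of F G g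

theorem of_mul_charSum [Fintype G] (χ : G →* F) (g : G) :
    of F G g * charSum χ = χ g • charSum χ := by
  rw [charSum, Finset.mul_sum, Finset.smul_sum]
  refine Fintype.sum_equiv (Equiv.mulLeft g) _ _ fun h => ?_
  rw [mul_smul_comm, ← map_mul, smul_smul, Equiv.coe_mulLeft, mul_comm (χ g), ← map_mul]
  congr 2
  group

theorem coeff_charSum_one [Fintype G] (χ : G →* F) : (charSum χ).coeff 1 = 1 := by
  classical
  rw [charSum, coeff_sum, Finsupp.finsetSum_apply, Finset.sum_eq_single 1]
  · simp
  · intro g _ hg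
    simp [hg]
  · simp

/-- A one-dimensional module as a left ideal. -/
theorem isModel_oneDim [Fintype G] (χ : G →* F) : IsModel (oneDim χ) (charSum χ) := by
  refine IsModel.mk (LinearMap.toSpanSingleton F _ (charSum χ)) (fun a b hab => ?_)
    Submodule.span_univ (fun g v _ => ?_) ⟨1, by simp⟩
    fun v _ => Submodule.smul_of_tower_mem _ v (Ideal.mem_span_singleton_self _)
  · have h := congrArg (fun z : MonoidAlgebra F G => z.coeff 1) hab
    simpa [coeff_charSum_one] using h
  · rw [LinearMap.toSpanSingleton_apply, LinearMap.toSpanSingleton_apply, mul_smul_comm,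
      of_mul_charSum, smul_smul, mul_comm v]
    rfl

end Model

/-! ### Induced modules as left ideals -/

section Ind

variable {F : Type u} [Field F] {G H : Type} [Group G] [Group H] {V : Type u} [AddCommGroup V]
  [Module F V]

open Representation

theorem span_range_indVMk (φ : H →* G) (ρ : Representation F H V) :
    Submodule.span F {t | ∃ g v, IndV.mk φ ρ g v = t} = ⊤ := by
  set W := Submodule.span F {t | ∃ g v, IndV.mk φ ρ g v = t} with hW
  have h : W.mkQ = 0 := IndV.hom_ext φ ρ fun g => LinearMap.ext fun v =>
    (Submodule.Quotient.mk_eq_zero W).2 (Submodule.subset_span ⟨g, v, rfl⟩)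
  rw [← Submodule.ker_mkQ W, h, LinearMap.ker_zero]

theorem indVMk_mul (φ : H →* G) (ρ : Representation F H V) (g : G) (h : H) (v : V) :
    IndV.mk φ ρ (φ h * g) (ρ h v) = IndV.mk φ ρ g v := by
  have e := Coinvariants.mk_self_apply (Representation.tprod ((leftRegular F G).comp φ) ρ) h
    (TensorProduct.tmul F (single g 1) v)
  simpa using e

/-- Induction of left ideals from a subgroup. -/
theorem isModel_ind {φ : H →* G} (hφ : Function.Injective φ) {ρ : Representation F H V}
    {x : MonoidAlgebra F H} (h : IsModel ρ x) :
    IsModel (ind φ ρ) (mapDomainRingHom F φ x) := by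
  obtain ⟨j, hj, he, hs⟩ := h
  let φ' : MonoidAlgebra F H →ₗ[F] MonoidAlgebra F G := mapDomainLinearMap F F φ
  have hφ' : ∀ y, φ' y = mapDomainRingHom F φ y := fun y => rfl
  let inv : MonoidAlgebra F G →ₗ[F] MonoidAlgebra F G := mapDomainLinearMap F F fun g => g⁻¹
  -- The inverse is needed because `IndV` identifies (φ h g, ρ h v) with (g, v) and lets G act by
  -- right multiplication with inverses on the first entry.
  obtain ⟨Ψ, hΨ⟩ : ∃ Ψ : IndV φ ρ →ₗ[F] MonoidAlgebra F G, ∀ g v,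
      Ψ (IndV.mk φ ρ g v) = of F G g⁻¹ * mapDomainRingHom F φ (j v) := by
    refine ⟨Coinvariants.lift _ (TensorProduct.lift
      ((LinearMap.mul F (MonoidAlgebra F G)).compl₁₂ inv (φ' ∘ₗ j))) fun k => ?_, fun g v => ?_⟩
    · refine TensorProduct.ext (MonoidAlgebra.lhom_ext' fun g => LinearMap.ext_ring ?_)
      ext1 v
      simp [inv, hφ', he, mapDomain_mul, ← mul_assoc, single_mul_single]
    · simp [inv, hφ']
  -- For injectivity of Ψ a linear left inverse Λ is enough, equivariant or not. It is built from a
  -- linear retraction r of j and coset representatives t, writing g = t(g) φ(k(g)).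
  obtain ⟨r, hr⟩ := j.exists_leftInverse_of_injective (LinearMap.ker_eq_bot.2 hj)
  have ht : ∀ g : G, ∃ k : H, g = (g : G ⧸ φ.range).out * φ k := fun g => by
    obtain ⟨⟨_, k, rfl⟩, hk⟩ := QuotientGroup.mk_out_eq_mul φ.range g
    exact ⟨k⁻¹, by rw [hk]; simp⟩
  choose k hk using ht
  let t : G → G := fun g => (g : G ⧸ φ.range).out
  have htt : ∀ g l, t (t g * φ l) = t g := fun g l => by
    have h1 : ((t g * φ l : G) : G ⧸ φ.range) = (g : G ⧸ φ.range) := by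
      rw [QuotientGroup.mk_mul_of_mem _ (MonoidHom.mem_range.2 ⟨l, rfl⟩)]
      exact Quotient.out_eq _
    simp only [t] at h1 ⊢
    rw [h1]
  let Λ : MonoidAlgebra F G →ₗ[F] IndV φ ρ := (MonoidAlgebra.basis G F).constr F fun g =>
    IndV.mk φ ρ (t g)⁻¹ (r (of F H (k g)))
  have hΛ : ∀ g (y : MonoidAlgebra F H),
      Λ (of F G (t g) * mapDomainRingHom F φ y) = IndV.mk φ ρ (t g)⁻¹ (r y) := by
    intro g y
    induction y using MonoidAlgebra.induction_linear with
    | zero => simp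
    | add y z hy hz => simp only [map_add, mul_add, hy, hz]
    | single l c =>
      have h1 : Λ (of F G (t g * φ l)) = IndV.mk φ ρ (t g)⁻¹ (r (of F H l)) := by
        have h2 : Λ (of F G (t g * φ l)) = IndV.mk φ ρ (t (t g * φ l))⁻¹
            (r (of F H (k (t g * φ l)))) := (MonoidAlgebra.basis G F).constr_basis F _ _
        have h3 : k (t g * φ l) = l := by
          have h4 := hk (t g * φ l)
          change _ = t (t g * φ l) * _ at h4
          rw [htt] at h4
          exact (hφ (mul_left_cancel h4)).symm
        rw [h2, h3, htt]
      rw [mapDomainRingHom_apply, mapDomain_single, ← smul_of, ← smul_of, mul_smul_comm,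
        ← map_mul, map_smul, h1, map_smul, map_smul]
  have hΛΨ : Λ ∘ₗ Ψ = LinearMap.id := by
    refine IndV.hom_ext φ ρ fun g => LinearMap.ext fun v => ?_
    have h1 : IndV.mk φ ρ g v = IndV.mk φ ρ (t g⁻¹)⁻¹ (ρ (k g⁻¹) v) := by
      rw [← indVMk_mul φ ρ g (k g⁻¹) v]
      congr 2
      have h2 := hk g⁻¹
      change _ = t g⁻¹ * _ at h2
      refine eq_inv_of_mul_eq_one_right ?_
      rw [← mul_assoc, ← h2, inv_mul_cancel]
    have h3 := LinearMap.congr_fun hr (ρ (k g⁻¹) v)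
    change Λ (Ψ (IndV.mk φ ρ g v)) = IndV.mk φ ρ g v
    rw [h1, hΨ, inv_inv, hΛ]
    exact congrArg (IndV.mk φ ρ _) h3
  refine IsModel.mk Ψ (Function.LeftInverse.injective (g := Λ) (LinearMap.congr_fun hΛΨ))
    (span_range_indVMk φ ρ) ?_ ?_ ?_
  · rintro g _ ⟨g', v, rfl⟩
    rw [ind_mk, hΨ, hΨ, mul_inv_rev, inv_inv, map_mul, mul_assoc]
  · obtain ⟨v, hv⟩ := (hs x).1 (Ideal.mem_span_singleton_self _)
    exact ⟨IndV.mk φ ρ 1 v, by rw [hΨ, hv, inv_one, map_one, one_mul]⟩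
  · rintro _ ⟨g, v, rfl⟩
    obtain ⟨a, ha⟩ := Ideal.mem_span_singleton'.1 ((hs _).2 ⟨v, rfl⟩)
    rw [hΨ, ← ha, map_mul, ← mul_assoc]
    exact Ideal.mul_mem_left _ _ (Ideal.mem_span_singleton_self _)

end Ind

/-! ### Functoriality and expansion of outer products -/

section PiProd

variable {F : Type u} [Field F] {ι : Type} [Fintype ι] {H K : ι → Type} [∀ i, Group (H i)]
  [∀ i, Group (K i)]

theorem piProd_mapDomainRingHom (f : ∀ i, H i →* K i) (x : ∀ i, MonoidAlgebra F (H i)) :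
    piProd (fun i => mapDomainRingHom F (f i) (x i)) =
      mapDomainRingHom F (MonoidHom.pi fun i => (f i).comp (Pi.evalMonoidHom H i))
        (piProd x) := by
  let f' : ∀ i, MonoidAlgebra F (H i) →ₗ[F] MonoidAlgebra F (K i) := fun i =>
    mapDomainLinearMap F F (f i)
  let g' : MonoidAlgebra F (∀ i, H i) →ₗ[F] MonoidAlgebra F (∀ i, K i) :=
    mapDomainLinearMap F F (MonoidHom.pi fun i => (f i).comp (Pi.evalMonoidHom H i))
  refine congrArg (fun f => f x) (Basis.ext_multilinear
    (f := piProd.compLinearMap f') (g := g'.compMultilinearMap piProd)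
    (fun i => MonoidAlgebra.basis (H i) F) fun g => ?_)
  have e1 := piProd_of (F := F) g
  have e2 := piProd_of (F := F) fun i => f i (g i)
  simp only [MonoidAlgebra.basis_apply, LinearMap.compMultilinearMap_apply,
    MultilinearMap.compLinearMap_apply, of_apply, f', g', mapDomainLinearMap_single] at e1 e2 ⊢
  rw [e1, e2, mapDomainLinearMap_single]
  rfl

theorem piProd_sum_of [DecidableEq ι] {κ : ι → Type} [∀ i, Fintype (κ i)]
    (c : ∀ i, κ i → F) (g : ∀ i, κ i → H i) :
    piProd (fun i => ∑ k, c i k • of F (H i) (g i k)) =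
      ∑ k : ∀ i, κ i, (∏ i, c i (k i)) • of F (∀ i, H i) fun i => g i (k i) := by
  rw [MultilinearMap.map_sum]
  refine Finset.sum_congr rfl fun k _ => ?_
  rw [MultilinearMap.map_smul_univ, piProd_of]

theorem eq_sum_coeff {G : Type} [Group G] [Fintype G] (x : MonoidAlgebra F G) :
    x = ∑ g, x.coeff g • of F G g := by
  classical
  refine coeff_injective (Finsupp.ext fun g => ?_)
  rw [coeff_sum, Finsupp.finsetSum_apply, Finset.sum_eq_single g] <;>
    simp +contextual

theorem piProd_eq_sum [DecidableEq ι] [∀ i, Fintype (H i)] (x : ∀ i, MonoidAlgebra F (H i)) :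
    piProd x = ∑ g : ∀ i, H i, (∏ i, (x i).coeff (g i)) • of F (∀ i, H i) g := by
  conv_lhs => rw [show x = fun i => ∑ g, (x i).coeff g • of F (H i) g from
    funext fun i => eq_sum_coeff (x i)]
  exact piProd_sum_of _ _

end PiProd

/-! ### Powers of elements and block sums in wreath products -/

section Wreath

variable {F : Type u} [Field F] {G K : Type} [Group G] [Group K] {m : ℕ}

/-- The `m`-th power of an element of `F[G]`, as an element of `F[G ≀ S_m]`. -/
def basePow (m : ℕ) (x : MonoidAlgebra F G) : MonoidAlgebra F (Wreath G m) :=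
  baseHom F G m (piProd fun _ => x)

theorem basePow_mul (x y : MonoidAlgebra F G) :
    basePow m (x * y) = basePow m x * basePow m y := by
  rw [basePow, basePow, basePow, ← map_mul, ← piProd_mul]
  rfl

theorem basePow_smul (c : F) (x : MonoidAlgebra F G) :
    basePow m (c • x) = c ^ m • basePow m x := by
  have h1 := piProd.map_smul_univ (fun _ : Fin m => c) fun _ => x
  rw [Finset.prod_const, Finset.card_univ, Fintype.card_fin] at h1
  rw [basePow, h1]
  exact mapDomain_smul _ _ _

theorem basePow_mul_blockSum (x : MonoidAlgebra F G) :
    basePow m x * blockSum F G m = blockSum F G m * basePow m x := by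
  rw [basePow, blockSum, Finset.mul_sum, Finset.sum_mul]
  exact Finset.sum_congr rfl fun τ _ => (inr_mul_baseHom_piProd m τ fun _ => x).symm

/-- Functoriality of wreath products. -/
def wreathMap (f : G →* K) (m : ℕ) : Wreath G m →* Wreath K m :=
  SemidirectProduct.map (MonoidHom.pi fun j => f.comp (Pi.evalMonoidHom _ j)) (MonoidHom.id _)
    fun _ => rfl

theorem mapDomainRingHom_basePow (f : G →* K) (x : MonoidAlgebra F G) :
    mapDomainRingHom F (wreathMap f m) (basePow m x) = basePow m (mapDomainRingHom F f x) := by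
  rw [basePow, basePow, piProd_mapDomainRingHom (H := fun _ => G) (K := fun _ => K) fun _ => f,
    ← RingHom.comp_apply, ← RingHom.comp_apply, ← mapDomainRingHom_comp, ← mapDomainRingHom_comp]
  congr 2

theorem mapDomainRingHom_blockSum (f : G →* K) :
    mapDomainRingHom F (wreathMap f m) (blockSum F G m) = blockSum F K m := by
  rw [blockSum, blockSum, map_sum]
  refine Finset.sum_congr rfl fun τ _ => ?_
  rw [of_apply, mapDomainRingHom_apply, mapDomain_single, of_apply]
  congr 1
  exact SemidirectProduct.map_inr _ _ _ _

end Wreath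

/-! ### Elements of F[S_n] written on blocks -/

section Block

variable {F : Type u} [Field F] {n : ℕ} (q : Composition n) (e : Letters q ≃ Fin n)

/-- The homomorphism `∏ (S_i ≀ S_{m_i}) → S_n`. -/
abbrev symmWreathPerm : WreathProd (fun i => Equiv.Perm (Fin i)) q →* Equiv.Perm (Fin n) :=
  wreathProdPerm (fun i => MonoidHom.id (Equiv.Perm (Fin i))) q e

/-- The product of the elements `z i`, written on all blocks of `i` letters. -/
def blockProd (z : ∀ i, MonoidAlgebra F (Equiv.Perm (Fin i))) :
    MonoidAlgebra F (Equiv.Perm (Fin n)) :=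
  mapDomainRingHom F (symmWreathPerm q e)
    (piProd fun i : Finset.Icc 1 n => basePow (mult q i) (z i))

/-- The sum of all permutations of the blocks of equal lengths. -/
def blockPermSum (F : Type u) [Field F] : MonoidAlgebra F (Equiv.Perm (Fin n)) :=
  mapDomainRingHom F (symmWreathPerm q e)
    (piProd fun i : Finset.Icc 1 n => blockSum F (Equiv.Perm (Fin i)) (mult q i))

theorem blockProd_mul (y z : ∀ i, MonoidAlgebra F (Equiv.Perm (Fin i))) :
    blockProd q e (fun i => y i * z i) = blockProd q e y * blockProd q e z := by
  unfold blockProd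
  rw [← map_mul]
  refine congrArg _ ?_
  rw [← piProd_mul]
  exact congrArg _ (funext fun i => basePow_mul _ _)

theorem blockProd_mul_blockPermSum_comm (z : ∀ i, MonoidAlgebra F (Equiv.Perm (Fin i))) :
    blockProd q e z * blockPermSum q e F = blockPermSum q e F * blockProd q e z := by
  unfold blockProd blockPermSum
  rw [← RingHom.map_mul, ← RingHom.map_mul, ← piProd_mul, ← piProd_mul]
  exact congrArg _ (congrArg _ <| funext fun i => basePow_mul_blockSum (z i))

/-- If i is not a part of q, the i-th factor is an empty product. This is why nothing is required of
indices divisible by p that do not occur in q. -/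
theorem blockProd_congr {y z : ∀ i, MonoidAlgebra F (Equiv.Perm (Fin i))}
    (h : ∀ i ∈ q.blocks, y i = z i) : blockProd q e y = blockProd q e z := by
  unfold blockProd
  refine congrArg _ (congrArg _ (funext fun i => ?_))
  unfold basePow
  refine congrArg _ (congrArg _ (funext fun j => ?_))
  exact h i (List.count_pos_iff.1 j.pos)

theorem blockProd_smul (c : ℕ → F) (y : ∀ i, MonoidAlgebra F (Equiv.Perm (Fin i))) :
    blockProd q e (fun i => c i • y i) =
      (∏ i : Finset.Icc 1 n, c i ^ mult q i) • blockProd q e y := by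
  unfold blockProd
  simp only [basePow_smul]
  rw [MultilinearMap.map_smul_univ]
  exact mapDomain_smul _ _ _

theorem symmWreathPerm_of_trans (e e' : Letters q ≃ Fin n) :
    symmWreathPerm q e' = (MulAut.conj (e.symm.trans e' : Equiv.Perm (Fin n))).toMonoidHom.comp
      (symmWreathPerm q e) := by
  ext w x
  simp [symmWreathPerm, wreathProdPerm]

theorem mapDomainRingHom_conj {G : Type} [Group G] (g : G) (x : MonoidAlgebra F G) :
    mapDomainRingHom F (MulAut.conj g).toMonoidHom x = of F G g * x * of F G g⁻¹ := by
  induction x using MonoidAlgebra.induction_linear with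
  | zero => simp
  | add y z hy hz => simp only [map_add, mul_add, add_mul, hy, hz]
  | single h c => simp [single_mul_single]

/-- Changing the identification of the letters conjugates the embedding of the wreath products, so
up to isomorphism one convenient identification suffices. -/
theorem blockProd_mul_blockPermSum_of_trans (e e' : Letters q ≃ Fin n)
    (z : ∀ i, MonoidAlgebra F (Equiv.Perm (Fin i))) :
    blockProd q e' z * blockPermSum q e' F =
      of F (Equiv.Perm (Fin n)) (e.symm.trans e') *
        (blockProd q e z * blockPermSum q e F) *
        of F (Equiv.Perm (Fin n)) (e.symm.trans e')⁻¹ := by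
  unfold blockProd blockPermSum
  rw [← RingHom.map_mul, ← RingHom.map_mul, ← mapDomainRingHom_conj, symmWreathPerm_of_trans q e e',
    mapDomainRingHom_comp, RingHom.comp_apply]

theorem wreathProdPerm_eq_comp {G : ℕ → Type} [∀ i, Group (G i)]
    (φ : ∀ i, G i →* Equiv.Perm (Fin i)) :
    wreathProdPerm φ q e = (symmWreathPerm q e).comp
      (MonoidHom.pi fun i : Finset.Icc 1 n => (wreathMap (φ i) (mult q i)).comp
        (Pi.evalMonoidHom (fun i : Finset.Icc 1 n => Wreath (G i) (mult q i)) i)) :=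
  rfl

/-- The module induced from `∏ (G_i ≀ S_{m_i})`, as a left ideal. -/
theorem isModel_inducedWreath {G : ℕ → Type} [∀ i, Group (G i)]
    {φ : ∀ i, G i →* Equiv.Perm (Fin i)} (hφ : ∀ i, Function.Injective (φ i))
    {V : ℕ → Type u} [∀ i, AddCommGroup (V i)] [∀ i, Module F (V i)]
    {ρ : ∀ i, Representation F (G i) (V i)} {x : ∀ i, MonoidAlgebra F (G i)}
    (h : ∀ i, IsModel (ρ i) (x i)) :
    IsModel (inducedWreath φ ρ q e)
      (blockProd q e (fun i => mapDomainRingHom F (φ i) (x i)) * blockPermSum q e F) := by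
  have h1 := isModel_ind (wreathProdPerm_injective φ hφ q e)
    (isModel_outerTensor (ρ := fun i : Finset.Icc 1 n => wreathPower (ρ i) (mult q i))
      fun i : Finset.Icc 1 n => isModel_wreathPower (h i) (mult q i))
  have h2 : mapDomainRingHom F (wreathProdPerm φ q e) (piProd fun i : Finset.Icc 1 n =>
        baseHom F (G i) (mult q i) (piProd fun _ => x i) * blockSum F (G i) (mult q i)) =
      blockProd q e (fun i => mapDomainRingHom F (φ i) (x i)) * blockPermSum q e F := by
    unfold blockProd blockPermSum
    rw [← map_mul, ← piProd_mul, wreathProdPerm_eq_comp, mapDomainRingHom_comp,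
      RingHom.comp_apply, ← piProd_mapDomainRingHom]
    refine congrArg _ (congrArg _ (funext fun i => ?_))
    rw [Pi.mul_apply, ← mapDomainRingHom_basePow, ← mapDomainRingHom_blockSum (φ i), ← map_mul]
    rfl
  exact h2 ▸ h1

end Block

/-! ### Expanding ω into signed permutations -/

section SignedProducts

variable {F : Type u} [Field F] {n : ℕ}

/-- The ordered product of the inverses of the permutations `c i` with `i ∈ A`. -/
def cycleProd (c : Fin n → Equiv.Perm (Fin n)) (A : Finset (Fin n)) (l : List (Fin n)) :
    Equiv.Perm (Fin n) :=
  (l.map fun i => if i ∈ A then (c i)⁻¹ else 1).prod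

theorem cycleProd_insert_of_notMem (c : Fin n → Equiv.Perm (Fin n)) {A : Finset (Fin n)}
    {l : List (Fin n)} {i : Fin n} (hi : i ∉ l) :
    cycleProd c (insert i A) l = cycleProd c A l := by
  unfold cycleProd
  congr 1
  refine List.map_congr_left fun j hj => ?_
  have : j ≠ i := fun h => hi (h ▸ hj)
  simp [this]

theorem list_prod_one_sub_of (c : Fin n → Equiv.Perm (Fin n)) {l : List (Fin n)} (hl : l.Nodup) :
    (l.map fun i => 1 - of F (Equiv.Perm (Fin n)) (c i)⁻¹).prod =
      ∑ A ∈ l.toFinset.powerset, (-1 : F) ^ A.card • of F _ (cycleProd c A l) := by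
  induction l with
  | nil => simp [cycleProd, one_def]
  | cons i l ih =>
    obtain ⟨hi, hl⟩ := List.nodup_cons.1 hl
    rw [List.map_cons, List.prod_cons, ih hl, List.toFinset_cons,
      Finset.sum_powerset_insert (by simpa using hi), sub_mul, one_mul, sub_eq_add_neg,
      Finset.mul_sum, ← Finset.sum_neg_distrib]
    congr 1
    · refine Finset.sum_congr rfl fun A hA => ?_
      have hiA : i ∉ A := fun h => hi (by simpa using Finset.mem_powerset.1 hA h)
      rw [cycleProd, cycleProd, List.map_cons, List.prod_cons, if_neg hiA, one_mul]
    · refine Finset.sum_congr rfl fun A hA => ?_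
      have hiA : i ∉ A := fun h => hi (by simpa using Finset.mem_powerset.1 hA h)
      have h : cycleProd c (insert i A) (i :: l) = (c i)⁻¹ * cycleProd c A l := by
        rw [← cycleProd_insert_of_notMem c hi, cycleProd, cycleProd, List.map_cons,
          List.prod_cons, if_pos (Finset.mem_insert_self i A)]
      rw [h, Finset.card_insert_of_notMem hiA, map_mul, mul_smul_comm, pow_succ, mul_neg_one,
        neg_smul]

/-- Each `c i` acts on the letters up to `i` in the block of `i` as an ascending cycle. -/
structure IsCycleFamily {κ : Type} (b : Fin n → κ) (c : Fin n → Equiv.Perm (Fin n)) : Prop where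
  block : ∀ i x, b (c i x) = b x
  fix : ∀ i x, i < x → c i x = x
  mono : ∀ i x y, x < y → y < i → b x = b y → c i x < c i y
  first : ∀ i x, x < i → b x = b i → c i i < c i x

variable {κ : Type} {b : Fin n → κ} {c : Fin n → Equiv.Perm (Fin n)}

theorem perm_lt_of_fix {σ : Equiv.Perm (Fin n)} {i : Fin n} (h : ∀ x, i ≤ x → σ x = x) {a : Fin n}
    (ha : a < i) : σ a < i := by
  by_contra! h'
  exact absurd (σ.injective (h _ h')) (by rintro h2; rw [h2] at h'; exact absurd ha (not_lt.2 h'))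

/-- Induction on the largest index i. Appending it replaces σ⁻¹ by c_i σ⁻¹ when i ∈ A; here σ⁻¹
fixes all letters from i on, and c_i preserves the order of the earlier letters of each block while
moving i below the earlier letters of its own block. So membership of y in A decides, all at once,
how y compares with the smaller letters of its block. -/
theorem cycleProd_spec (hc : IsCycleFamily b c) (A : Finset (Fin n)) (l : List (Fin n))
    (hl : l.Pairwise (· < ·)) :
    (∀ x, b ((cycleProd c A l)⁻¹ x) = b x) ∧
    (∀ x, (∀ j ∈ l, j < x) → (cycleProd c A l)⁻¹ x = x) ∧
    ∀ x y, x < y → b x = b y →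
      ((cycleProd c A l)⁻¹ x < (cycleProd c A l)⁻¹ y ↔ ¬ (y ∈ l ∧ y ∈ A)) := by
  induction l using List.reverseRecOn with
  | nil => simp +contextual [cycleProd]
  | append_singleton l i ih =>
    obtain ⟨hl1, -, hl2⟩ := List.pairwise_append.1 hl
    have hl2 : ∀ j ∈ l, j < i := fun j hj => hl2 j hj i (by simp)
    obtain ⟨ih1, ih2, ih3⟩ := ih hl1
    set σ := cycleProd c A l with hσ
    have hfix : ∀ x, i ≤ x → σ⁻¹ x = x := fun x hx => ih2 x fun j hj => (hl2 j hj).trans_le hx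
    by_cases hi : i ∈ A
    · have e : ∀ x, (cycleProd c A (l ++ [i]))⁻¹ x = c i (σ⁻¹ x) := fun x => by
        simp [cycleProd, hi, hσ]
      simp only [e]
      refine ⟨fun x => by rw [hc.block, ih1], fun x hx => ?_, fun x y hxy hb => ?_⟩
      · have hix := hx i (by simp)
        rw [hfix x hix.le, hc.fix i x hix]
      · rcases lt_trichotomy y i with hy | rfl | hy
        · have hx' := perm_lt_of_fix hfix (hxy.trans hy)
          have hy' := perm_lt_of_fix hfix hy
          have h1 := ih3 x y hxy hb
          have hb' : b (σ⁻¹ x) = b (σ⁻¹ y) := by rw [ih1, ih1, hb]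
          have h2 : c i (σ⁻¹ x) < c i (σ⁻¹ y) ↔ σ⁻¹ x < σ⁻¹ y := by
            refine ⟨fun h => ?_, fun h => hc.mono i _ _ h hy' hb'⟩
            by_contra! h'
            rcases h'.lt_or_eq with h' | h'
            · exact absurd h (hc.mono i _ _ h' hx' hb'.symm).not_gt
            · rw [h'] at h
              exact lt_irrefl _ h
          rw [h2, h1]
          simp [hy.ne]
        · have hx' := perm_lt_of_fix hfix hxy
          have h1 := hc.first y (σ⁻¹ x) hx' (by rw [ih1, hb])
          rw [hfix y le_rfl]
          simpa [hi] using h1.le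
        · have hyl : y ∉ l := fun h => absurd (hl2 y h) hy.not_gt
          rw [hfix y hy.le, hc.fix i y hy]
          simp only [List.mem_append, hyl, List.mem_singleton, hy.ne', or_self, false_and,
            not_false_eq_true, iff_true]
          have h3 : ∀ z, y ≤ z → (c i * σ⁻¹) z = z := fun z hz => by
            rw [Equiv.Perm.mul_apply, hfix z (hy.trans_le hz).le, hc.fix i z (hy.trans_le hz)]
          exact perm_lt_of_fix h3 hxy
    · have e : cycleProd c A (l ++ [i]) = σ := by
        simp [cycleProd, hi, hσ]
      rw [e]
      refine ⟨ih1, fun x hx => ih2 x fun j hj => hx j (by simp [hj]), fun x y hxy hb => ?_⟩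
      rw [ih3 x y hxy hb]
      have : y ∈ A → y ≠ i := fun h h' => hi (h' ▸ h)
      simp only [List.mem_append, List.mem_singleton]
      tauto

theorem perm_eq_one_of_strictMono {σ : Equiv.Perm (Fin n)} (h : StrictMono σ) : σ = 1 :=
  Equiv.ext fun x => congrFun ((StrictMono.range_inj h (strictMono_id (α := Fin n))).1
    (by rw [σ.surjective.range_eq, Set.range_id])) x

theorem isCycleFamily_cycleRange (n : ℕ) :
    IsCycleFamily (fun _ : Fin n => ()) (fun i => Fin.cycleRange i) where
  block _ _ := rfl
  fix i x h := Fin.cycleRange_of_gt h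
  mono i x y hxy hy _ := by
    rw [Fin.lt_def, Fin.coe_cycleRange_of_lt (hxy.trans hy), Fin.coe_cycleRange_of_lt hy]
    have := Fin.lt_def.1 hxy
    omega
  first i x h _ := by
    have : NeZero n := ⟨by have := i.2; omega⟩
    rw [Fin.cycleRange_self, Fin.lt_def, Fin.coe_cycleRange_of_lt h, Fin.val_zero]
    exact Nat.succ_pos _

/-- `ω_n` as a signed sum of the permutations whose words are unimodal. -/
theorem exists_omega_eq_sum (F : Type u) [Field F] (n : ℕ) [NeZero n] :
    ∃ σ : Finset (Fin n) → Equiv.Perm (Fin n),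
      omega F n = ∑ A ∈ (Finset.univ.erase 0).powerset, (-1 : F) ^ A.card • of F _ (σ A) ∧
      ∀ A ⊆ Finset.univ.erase 0, ∀ x y, x < y → ((σ A)⁻¹ x < (σ A)⁻¹ y ↔ y ∉ A) := by
  set l := (List.finRange n).filter fun i : Fin n => i.val ≠ 0 with hl
  have hl1 : l.Pairwise (· < ·) := (List.pairwise_lt_finRange n).filter _
  have hl2 : l.toFinset = Finset.univ.erase 0 := by
    ext x
    rw [List.mem_toFinset, hl, List.mem_filter]
    simp
  refine ⟨fun A => cycleProd (fun i => Fin.cycleRange i) A l, ?_, fun A hA x y hxy => ?_⟩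
  · rw [← hl2]
    exact list_prod_one_sub_of (F := F) (fun i => Fin.cycleRange i)
      (hl1.imp fun h => h.ne)
  · rw [(cycleProd_spec (isCycleFamily_cycleRange n) A l hl1).2.2 x y hxy rfl]
    have : y ∈ A → y ∈ l := fun h => List.mem_toFinset.1 (hl2 ▸ hA h)
    tauto

end SignedProducts

/-! ### Alternating sums over subsets -/

section SignSums

variable {F : Type u} [Field F] {α ι : Type} [DecidableEq α]

theorem sum_powerset_neg_one_pow_eq_zero {S : Finset α} {m : α} (hm : m ∈ S) (g : Finset α → F)
    (hg : ∀ A ⊆ S, m ∉ A → g (insert m A) = g A) :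
    ∑ A ∈ S.powerset, (-1 : F) ^ A.card * g A = 0 := by
  rw [← Finset.insert_erase hm, Finset.sum_powerset_insert (Finset.notMem_erase m S),
    ← Finset.sum_add_distrib]
  refine Finset.sum_eq_zero fun A hA => ?_
  have hA' := Finset.mem_powerset.1 hA
  have hmA : m ∉ A := fun h => Finset.notMem_erase m S (hA' h)
  rw [Finset.card_insert_of_notMem hmA, hg A (hA'.trans (Finset.erase_subset _ _)) hmA]
  ring

/-- Each factor depends only on whether one point M i lies in A. Grouping the factors by this point
turns the alternating sum into the expansion of a product of differences. -/
theorem sum_powerset_neg_one_pow_prod [Fintype ι] {S : Finset α} {M : ι → α} (hM : ∀ i, M i ∈ S)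
    (p s : ι → F) :
    ∑ A ∈ S.powerset, (-1 : F) ^ A.card * ∏ i, (if M i ∈ A then p i else s i) =
      ∏ x ∈ S, (∏ i with M i = x, s i - ∏ i with M i = x, p i) := by
  rw [Finset.prod_sub]
  refine Finset.sum_congr rfl fun A hA => ?_
  rw [mul_assoc, ← Finset.prod_fiberwise_of_maps_to (fun i _ => hM i),
    ← Finset.prod_sdiff (Finset.mem_powerset.1 hA)]
  congr 2 <;> refine Finset.prod_congr rfl fun x hx => Finset.prod_congr rfl fun i hi => ?_
  · rw [(Finset.mem_filter.1 hi).2, if_neg (Finset.mem_sdiff.1 hx).2]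
  · rw [(Finset.mem_filter.1 hi).2, if_pos hx]

end SignSums

/-! ### Multiplying ω_n by descent-weighted sums; the Dynkin–Specht–Wever relation -/

section Omega

variable {F : Type u} [Field F] {r : ℕ}

open Classical in
/-- The sum of all permutations, weighted by `u i` for each descent and `v i` for each ascent. -/
def descentSum (u v : Fin r → F) : MonoidAlgebra F (Equiv.Perm (Fin (r + 1))) :=
  ∑ τ : Equiv.Perm (Fin (r + 1)),
    (∏ i, if τ i.succ < τ i.castSucc then u i else v i) • of F _ τ

open Classical in
theorem coeff_descentSum (u v : Fin r → F) (τ : Equiv.Perm (Fin (r + 1))) :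
    (descentSum u v).coeff τ = ∏ i, if τ i.succ < τ i.castSucc then u i else v i := by
  rw [descentSum, coeff_sum, Finsupp.finsetSum_apply, Finset.sum_eq_single τ] <;>
    simp +contextual

/-- The larger one of the letters at two adjacent positions. -/
def adjMax (τ : Equiv.Perm (Fin (r + 1))) (i : Fin r) : Fin (r + 1) := max (τ i.castSucc) (τ i.succ)

theorem adjMax_mem (τ : Equiv.Perm (Fin (r + 1))) (i : Fin r) :
    adjMax τ i ∈ (Finset.univ.erase 0 : Finset (Fin (r + 1))) := by
  refine Finset.mem_erase.2 ⟨fun h => ?_, Finset.mem_univ _⟩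
  have h1 : τ i.castSucc = 0 := le_antisymm ((le_max_left _ _).trans h.le) (Fin.zero_le _)
  have h2 : τ i.succ = 0 := le_antisymm ((le_max_right _ _).trans h.le) (Fin.zero_le _)
  exact (Fin.castSucc_lt_succ (i := i)).ne (τ.injective (h1.trans h2.symm))

theorem descentSum_zero_one : descentSum (0 : Fin r → F) 1 = 1 := by
  classical
  refine coeff_injective (Finsupp.ext fun τ => ?_)
  rw [coeff_descentSum, one_def, coeff_single, Finsupp.single_apply]
  split_ifs with h
  · refine Finset.prod_eq_one fun i _ => ?_
    rw [← h]
    exact if_neg (Fin.castSucc_lt_succ (i := i)).not_gt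
  · by_contra h'
    refine h (perm_eq_one_of_strictMono (Fin.strictMono_iff_lt_succ.2 fun i => ?_)).symm
    by_contra! h''
    refine h' (Finset.prod_eq_zero (Finset.mem_univ i) ?_)
    rw [if_pos (lt_of_le_of_ne h'' fun h => ?_)]
    · rfl
    · exact (Fin.castSucc_lt_succ (i := i)).ne' (τ.injective h)

open Classical in
-- In the expansion of ω over subsets A, whether σ_A⁻¹ τ descends at position i depends only on
-- whether the larger of the adjacent letters τ(i), τ(i+1) lies in A. Hence the alternating sum
-- factorises over the possible larger letters.
theorem coeff_omega_mul_descentSum (u v : Fin r → F) (τ : Equiv.Perm (Fin (r + 1))) :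
    (omega F (r + 1) * descentSum u v).coeff τ =
      ∏ x ∈ Finset.univ.erase 0,
        (∏ i with adjMax τ i = x, (if τ i.succ < τ i.castSucc then u i else v i) -
          ∏ i with adjMax τ i = x, (if τ i.succ < τ i.castSucc then v i else u i)) := by
  obtain ⟨σ, hσ, hσ'⟩ := exists_omega_eq_sum F (r + 1)
  rw [← sum_powerset_neg_one_pow_prod (adjMax_mem τ), hσ, Finset.sum_mul, coeff_sum,
    Finsupp.finsetSum_apply]
  refine Finset.sum_congr rfl fun A hA => ?_
  have hA := hσ' A (Finset.mem_powerset.1 hA)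
  rw [smul_mul_assoc, coeff_smul_apply, of_apply, coeff_single_mul_apply, one_mul,
    coeff_descentSum, smul_eq_mul]
  congr 1
  refine Finset.prod_congr rfl fun i _ => ?_
  simp only [Equiv.Perm.mul_apply]
  have hne : τ i.castSucc ≠ τ i.succ := fun h =>
    (Fin.castSucc_lt_succ (i := i)).ne (τ.injective h)
  rcases hne.lt_or_gt with h | h
  · have h1 : adjMax τ i = τ i.succ := max_eq_right h.le
    have h2 := hA _ _ h
    have h3 : (σ A)⁻¹ (τ i.succ) < (σ A)⁻¹ (τ i.castSucc) ↔ τ i.succ ∈ A := by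
      rw [← not_iff_not, ← h2, not_lt, le_iff_lt_or_eq, or_iff_left]
      exact fun h => hne ((σ A)⁻¹.injective h)
    rw [h1, if_neg h.not_gt, if_neg h.not_gt]
    exact if_congr h3 rfl rfl
  · have h1 : adjMax τ i = τ i.castSucc := max_eq_left h.le
    have h2 := hA _ _ h
    rw [h1, if_pos h, if_pos h]
    by_cases hm : τ i.castSucc ∈ A
    · rw [if_pos hm]
      exact if_neg fun h3 => h2.1 h3 hm
    · rw [if_neg hm]
      exact if_pos (h2.2 hm)

theorem image_adjMax_of_injective {τ : Equiv.Perm (Fin (r + 1))}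
    (h : Function.Injective (adjMax τ)) :
    Finset.univ.image (adjMax τ) = (Finset.univ.erase 0 : Finset (Fin (r + 1))) := by
  refine Finset.eq_of_subset_of_card_le (fun x hx => ?_) ?_
  · obtain ⟨i, -, rfl⟩ := Finset.mem_image.1 hx
    exact adjMax_mem τ i
  · rw [Finset.card_image_of_injective _ h]
    simp

theorem exists_adjMax_ne_of_not_injective {τ : Equiv.Perm (Fin (r + 1))}
    (h : ¬ Function.Injective (adjMax τ)) :
    ∃ x ∈ (Finset.univ.erase 0 : Finset (Fin (r + 1))), ∀ i, adjMax τ i ≠ x := by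
  by_contra! h'
  have h1 : Finset.univ.image (adjMax τ) = (Finset.univ.erase 0 : Finset (Fin (r + 1))) := by
    refine Finset.Subset.antisymm (fun x hx => ?_) fun x hx => ?_
    · obtain ⟨i, -, rfl⟩ := Finset.mem_image.1 hx
      exact adjMax_mem τ i
    · obtain ⟨i, hi⟩ := h' x hx
      exact Finset.mem_image.2 ⟨i, Finset.mem_univ i, hi⟩
  refine h fun i j hij => Finset.injOn_of_card_image_eq (f := adjMax τ) (s := Finset.univ) ?_
    (Finset.mem_coe.2 (Finset.mem_univ i)) (Finset.mem_coe.2 (Finset.mem_univ j)) hij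
  rw [h1]
  simp

open Classical in
-- There are r adjacent pairs and r nonzero letters. If two pairs share their maximum, some nonzero
-- letter is the maximum of no pair and contributes 1 - 1 = 0; otherwise each letter contributes a
-- single difference.
theorem coeff_omega_mul_descentSum' (u v : Fin r → F) (τ : Equiv.Perm (Fin (r + 1))) :
    (omega F (r + 1) * descentSum u v).coeff τ = if Function.Injective (adjMax τ) then
      ∏ i, (if τ i.succ < τ i.castSucc then u i - v i else v i - u i) else 0 := by
  rw [coeff_omega_mul_descentSum]
  split_ifs with h
  · rw [← image_adjMax_of_injective h, Finset.prod_image fun i _ j _ hij => h hij]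
    refine Finset.prod_congr rfl fun i _ => ?_
    have h1 : Finset.univ.filter (fun j => adjMax τ j = adjMax τ i) = {i} := by
      ext j
      simp [h.eq_iff]
    rw [h1, Finset.prod_singleton, Finset.prod_singleton]
    split_ifs <;> rfl
  · obtain ⟨x, hx, hx'⟩ := exists_adjMax_ne_of_not_injective h
    refine Finset.prod_eq_zero hx ?_
    simp [hx']

open Classical in
theorem coeff_omega (τ : Equiv.Perm (Fin (r + 1))) :
    (omega F (r + 1)).coeff τ = if Function.Injective (adjMax τ) then
      ∏ i : Fin r, (if τ i.succ < τ i.castSucc then -1 else 1 : F) else 0 := by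
  rw [← mul_one (omega F (r + 1)), ← descentSum_zero_one, coeff_omega_mul_descentSum']
  simp

/-- Every factor of a nonzero coefficient is v_i - u_i up to a sign depending only on τ. The same
signs give ω itself, by the case u = 0, v = 1, where the weighted sum is the identity. -/
theorem omega_mul_descentSum (u v : Fin r → F) :
    omega F (r + 1) * descentSum u v = (∏ i, (v i - u i)) • omega F (r + 1) := by
  classical
  refine coeff_injective (Finsupp.ext fun τ => ?_)
  rw [coeff_omega_mul_descentSum', coeff_smul_apply, coeff_omega]
  split_ifs with h
  · rw [smul_eq_mul, ← Finset.prod_mul_distrib]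
    refine Finset.prod_congr rfl fun i _ => ?_
    split_ifs <;> ring
  · rw [smul_zero]

/-- A peak of the word is the maximum of both its adjacent pairs. Without peaks the word falls to
its minimum and then rises, and the maxima are exactly the letters other than the minimum. -/
theorem adjMax_injective_iff (τ : Equiv.Perm (Fin (r + 1))) :
    Function.Injective (adjMax τ) ↔
      ∃ k : Fin (r + 1), ∀ i : Fin r, τ i.succ < τ i.castSucc ↔ i.castSucc < k := by
  constructor
  · intro h
    let D : ℕ → Prop := fun m => ∃ h : m < r, τ (Fin.succ ⟨m, h⟩) < τ (Fin.castSucc ⟨m, h⟩)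
    have hD : Antitone D := by
      refine antitone_nat_of_succ_le fun m => ?_
      rintro ⟨h1, h2⟩
      refine ⟨by omega, ?_⟩
      by_contra h3
      have h4 : adjMax τ ⟨m, by omega⟩ = adjMax τ ⟨m + 1, h1⟩ :=
        (max_eq_right (not_lt.1 h3)).trans (max_eq_left h2.le).symm
      have := h h4
      simp at this
    have hex : ∃ m, ¬ D m := ⟨r, fun h => lt_irrefl _ h.1⟩
    classical
    refine ⟨⟨Nat.find hex, Nat.lt_succ_of_le (Nat.find_min' hex fun h => lt_irrefl _ h.1)⟩,
      fun i => ⟨fun hi => ?_, fun hi => ?_⟩⟩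
    · rw [Fin.lt_def]
      by_contra! h'
      exact Nat.find_spec hex (hD h' ⟨i.2, hi⟩)
    · exact (not_not.1 (Nat.find_min hex hi)).2
  · rintro ⟨k, hk⟩
    have h1 : ∀ i : Fin r, adjMax τ i = τ (if i.castSucc < k then i.castSucc else i.succ) := by
      intro i
      split_ifs with h
      · exact max_eq_left ((hk i).2 h).le
      · exact max_eq_right (not_lt.1 fun h' => h ((hk i).1 h'))
    intro i j hij
    rw [h1, h1] at hij
    have h2 := τ.injective hij
    simp only [Fin.lt_def, Fin.ext_iff] at h2 ⊢
    split_ifs at h2 <;> simp_all <;> omega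

theorem prod_ite_castSucc_lt (k : Fin (r + 1)) :
    ∏ i : Fin r, (if i.castSucc < k then (-1 : F) else 1) = (-1) ^ (k : ℕ) := by
  rw [Finset.prod_ite, Finset.prod_const_one, mul_one, Finset.prod_const]
  congr 1
  have : (Finset.univ.filter fun i : Fin r => i.castSucc < k).map Fin.castSuccEmb =
      Finset.Iio k := by
    ext x
    simp only [Finset.mem_map, Finset.mem_filter, Finset.mem_univ, true_and, Finset.mem_Iio]
    constructor
    · rintro ⟨i, hi, rfl⟩
      exact hi
    · intro hx
      exact ⟨x.castLT (by have := k.2; have := Fin.lt_def.1 hx; omega), hx, rfl⟩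
  rw [← Finset.card_map Fin.castSuccEmb, this, Fin.card_Iio]

theorem omega_eq_sum_descentSum : omega F (r + 1) = ∑ k : Fin (r + 1), (-1 : F) ^ (k : ℕ) •
    descentSum (fun i : Fin r => if i.castSucc < k then 1 else 0)
      (fun i => if i.castSucc < k then 0 else 1) := by
  classical
  refine coeff_injective (Finsupp.ext fun τ => ?_)
  have key : ∀ k : Fin (r + 1), (¬ ∀ i : Fin r, τ i.succ < τ i.castSucc ↔ i.castSucc < k) →
      (descentSum (fun i : Fin r => if i.castSucc < k then (1 : F) else 0)
        (fun i => if i.castSucc < k then 0 else 1)).coeff τ = 0 := by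
    intro k hk
    push Not at hk
    obtain ⟨i, hi⟩ := hk
    rw [coeff_descentSum]
    refine Finset.prod_eq_zero (Finset.mem_univ i) ?_
    rcases hi with ⟨h1, h2⟩ | ⟨h1, h2⟩
    · rw [if_pos h1, if_neg h2.not_gt] 
    · rw [if_neg h1.not_gt, if_pos h2]
  rw [coeff_omega, coeff_sum, Finsupp.finsetSum_apply]
  simp only [coeff_smul_apply]
  split_ifs with h
  · obtain ⟨k, hk⟩ := (adjMax_injective_iff τ).1 h
    rw [Finset.sum_eq_single k]
    · have h1 : (descentSum (fun i : Fin r => if i.castSucc < k then (1 : F) else 0)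
          (fun i => if i.castSucc < k then 0 else 1)).coeff τ = 1 := by
        rw [coeff_descentSum]
        refine Finset.prod_eq_one fun i _ => ?_
        by_cases h1 : i.castSucc < k
        · rw [if_pos ((hk i).2 h1), if_pos h1]
        · rw [if_neg fun h2 => h1 ((hk i).1 h2), if_neg h1]
      rw [h1, smul_eq_mul, mul_one, ← prod_ite_castSucc_lt k]
      exact Finset.prod_congr rfl fun i _ => if_congr (hk i) rfl rfl
    · intro k' _ hk'
      rw [key k', smul_zero]
      intro h'
      refine hk' (le_antisymm ?_ ?_)
      · by_contra! hlt
        have := (h' ⟨k, by have := k'.2; have := Fin.lt_def.1 hlt; omega⟩).2 hlt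
        exact lt_irrefl _ ((hk _).1 this)
      · by_contra! hlt
        have := (hk ⟨k', by have := k.2; have := Fin.lt_def.1 hlt; omega⟩).2 hlt
        exact lt_irrefl _ ((h' _).1 this)
    · simp
  · refine (Finset.sum_eq_zero fun k _ => ?_).symm
    rw [key k, smul_zero]
    exact fun hk => h ((adjMax_injective_iff τ).2 ⟨k, hk⟩)

/-- The Dynkin–Specht–Wever relation. -/
theorem omega_mul_omega {n : ℕ} (hn : 0 < n) :
    omega F n * omega F n = (n : F) • omega F n := by
  obtain ⟨r, rfl⟩ := Nat.exists_eq_succ_of_ne_zero hn.ne'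
  -- The summand of ω with exactly k initial descents carries the sign (-1)^k, and multiplying ω by
  -- its descent sum gives (-1)^k again. So each of the n summands contributes one copy of ω.
  have h : ∀ k : Fin (r + 1), omega F (r + 1) * ((-1 : F) ^ (k : ℕ) •
      descentSum (fun i : Fin r => if i.castSucc < k then 1 else 0)
        (fun i => if i.castSucc < k then 0 else 1)) = omega F (r + 1) := by
    intro k
    rw [mul_smul_comm, omega_mul_descentSum, smul_smul]
    have h1 : ∏ i : Fin r, ((if i.castSucc < k then (0 : F) else 1) -
        if i.castSucc < k then 1 else 0) = (-1) ^ (k : ℕ) := by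
      rw [← prod_ite_castSucc_lt]
      refine Finset.prod_congr rfl fun i _ => ?_
      split_ifs <;> ring
    rw [h1, ← mul_pow]
    simp
  conv_lhs => rw [omega_eq_sum_descentSum (F := F) (r := r), ← omega_eq_sum_descentSum]
  conv_lhs => enter [2]; rw [omega_eq_sum_descentSum]
  rw [Finset.mul_sum, Finset.sum_congr rfl fun k _ => h k, Finset.sum_const, Finset.card_univ,
    Fintype.card_fin, Nat.cast_smul_eq_nsmul]

/-- The coefficient of `ω_n` at a permutation fixing the first letter. -/
theorem coeff_omega_of_apply_zero {n : ℕ} [NeZero n] {τ : Equiv.Perm (Fin n)} (hτ : τ 0 = 0) :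
    (omega F n).coeff τ = if τ = 1 then 1 else 0 := by
  obtain ⟨σ, hσ, hσ'⟩ := exists_omega_eq_sum F n
  have h1 : σ ∅ = 1 := by
    have : (σ ∅)⁻¹ = 1 := perm_eq_one_of_strictMono fun x y hxy =>
      (hσ' ∅ (Finset.empty_subset _) x y hxy).2 (Finset.notMem_empty y)
    rwa [inv_eq_one] at this
  rw [hσ, coeff_sum, Finsupp.finsetSum_apply, Finset.sum_eq_single ∅]
  · rw [h1, coeff_smul_apply, of_apply, coeff_single, Finsupp.single_apply]
    simp [eq_comm]
  · intro A hA hne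
    obtain ⟨y, hy⟩ := Finset.nonempty_iff_ne_empty.2 hne
    have hA' := Finset.mem_powerset.1 hA
    rw [coeff_smul_apply, of_apply, coeff_single, Finsupp.single_apply, if_neg, smul_zero]
    rintro rfl
    -- A letter y ∈ A would precede the letter 0 in the word of τ, which begins with 0.
    have h2 : (0 : Fin n) < y := Fin.pos_iff_ne_zero.2 (Finset.mem_erase.1 (hA' hy)).1
    refine (hσ' A hA' 0 y h2).1 ?_ hy
    rw [Equiv.Perm.inv_eq_iff_eq.2 hτ.symm, Fin.pos_iff_ne_zero]
    intro h3
    rw [Equiv.Perm.inv_eq_iff_eq, hτ] at h3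
    exact h2.ne' h3
  · simp

end Omega

/-! ### Klyachko's theorem on Lie modules and cyclic groups -/

section Klyachko

variable {F : Type u} [Field F]

/-- The weights of Klyachko's element, written with cyclic descents. -/
theorem prod_descent_eq_prod_cyclic {r : ℕ} {ζ : F} (τ : Equiv.Perm (Fin (r + 1))) :
    ∏ i : Fin r, (if τ i.succ < τ i.castSucc then ζ ^ (i.val + 1) else 1) =
      ∏ i : Fin (r + 1), if τ (i + 1) < τ i then ζ ^ (i + 1).val else 1 := by
  -- The extra wrap-around position r has weight exponent r + 1 = 0 in `Fin (r + 1)`, so a cyclic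
  -- descent there costs nothing.
  rw [Fin.prod_univ_castSucc]
  simp [Fin.coeSucc_eq_succ]

/-- Raising all letters by one modulo n turns the largest letter, at position p, into the smallest.
The cyclic descent leaving p disappears and one entering p appears; all others persist. The weight
changes from ζ^(p+1) to ζ^p. -/
theorem prod_cyclic_finRotate {r : ℕ} {ζ : F} (hζ : ζ ^ (r + 1) = 1)
    (τ : Equiv.Perm (Fin (r + 1))) :
    ζ * ∏ i : Fin (r + 1), (if (finRotate (r + 1) * τ) (i + 1) < (finRotate (r + 1) * τ) i then
        ζ ^ (i + 1).val else 1) =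
      ∏ i : Fin (r + 1), if τ (i + 1) < τ i then ζ ^ (i + 1).val else 1 := by
  have hζ0 : ζ ≠ 0 := fun h => by simp [h] at hζ
  rcases r.eq_zero_or_pos with rfl | hr
  · have h1 : ζ = 1 := by simpa using hζ
    simp [h1]
  have hne : ∀ i : Fin (r + 1), i + 1 ≠ i := fun i h => by
    have : (1 : Fin (r + 1)) = 0 := by simpa using h
    rw [Fin.ext_iff, Fin.val_one', Fin.val_zero, Nat.mod_eq_of_lt (by omega)] at this
    omega
  obtain ⟨p, hp⟩ := τ.surjective (Fin.last r)
  have hlast : ∀ i, i ≠ p → τ i < Fin.last r := fun i hi =>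
    lt_of_le_of_ne (Fin.le_last _) fun h => hi (τ.injective (h.trans hp.symm))
  have hpt : ∀ i, (if finRotate (r + 1) (τ (i + 1)) < finRotate (r + 1) (τ i) then
        ζ ^ (i + 1).val else 1) * (if i = p then ζ ^ (i + 1).val else 1) =
      (if τ (i + 1) < τ i then ζ ^ (i + 1).val else 1) *
        (if i + 1 = p then ζ ^ (i + 1).val else 1) := by
    intro i
    by_cases h1 : i = p
    · subst h1
      rw [if_neg, if_pos rfl, if_pos, if_neg (hne i), mul_comm]
      · rw [hp]
        exact hlast _ (hne i)
      · rw [hp, finRotate_last]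
        exact not_lt.2 (Fin.zero_le _)
    · rw [if_neg h1]
      by_cases h2 : i + 1 = p
      · have hA : finRotate (r + 1) (τ (i + 1)) < finRotate (r + 1) (τ i) := by
          rw [h2, hp, finRotate_last, Fin.lt_def, coe_finRotate_of_ne_last (hlast i h1).ne]
          exact Nat.succ_pos _
        have hB : ¬ τ (i + 1) < τ i := by
          rw [h2, hp]
          exact not_lt.2 (Fin.le_last _)
        rw [if_pos hA, if_neg hB, if_pos h2, mul_comm]
      · rw [if_neg h2, mul_one, mul_one]
        refine if_congr ?_ rfl rfl
        rw [Fin.lt_def, coe_finRotate_of_ne_last (hlast i h1).ne,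
          coe_finRotate_of_ne_last (hlast _ h2).ne, Fin.lt_def]
        omega
  have h3 := Finset.prod_congr (s₁ := Finset.univ) rfl fun i _ => hpt i
  have h4 : ∏ i : Fin (r + 1), (if i + 1 = p then ζ ^ (i + 1).val else 1) = ζ ^ p.val := by
    refine (Fintype.prod_equiv (Equiv.addRight (1 : Fin (r + 1))) _
      (fun i => if i = p then ζ ^ i.val else 1) fun i => rfl).trans ?_
    simp
  have h5 : ζ ^ (p + 1).val = ζ * ζ ^ p.val := by
    rw [← pow_succ', Fin.val_add, ← pow_eq_pow_mod _ hζ, Fin.val_one', Nat.mod_eq_of_lt (by omega)]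
  rw [Finset.prod_mul_distrib, Finset.prod_mul_distrib, h4, Finset.prod_ite_eq',
    if_pos (Finset.mem_univ p), h5, ← mul_assoc] at h3
  rw [mul_comm]
  exact mul_right_cancel₀ (pow_ne_zero _ hζ0) h3

theorem charSum_mul_of_equivariant {G A : Type} [Group G] [Fintype G] [Group A] {χ : G →* F}
    {f : G →* A} {y : MonoidAlgebra F A} (h : ∀ g, of F A (f g) * y = χ g • y) :
    mapDomainRingHom F f (charSum χ) * y = (Fintype.card G : F) • y := by
  rw [charSum, map_sum, Finset.sum_mul, ← Finset.card_univ, Nat.cast_smul_eq_nsmul,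
    ← Finset.sum_const]
  refine Finset.sum_congr rfl fun g _ => ?_
  have h1 : mapDomainRingHom F f (χ g⁻¹ • of F G g) = χ g⁻¹ • of F A (f g) := by
    simp
  rw [h1, smul_mul_assoc, h, smul_smul, ← map_mul, inv_mul_cancel, map_one, one_smul]

variable {n : ℕ} [NeZero n]

theorem exists_cyc_apply_zero (x : Fin n) : ∃ g : cyc n, (g : Equiv.Perm (Fin n)) 0 = x := by
  refine ⟨cycGen n ^ x.val, ?_⟩
  obtain ⟨r, rfl⟩ := Nat.exists_eq_succ_of_ne_zero (NeZero.ne n)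
  have h : ∀ k : ℕ, k ≤ r → (((finRotate (r + 1)) ^ k) 0).val = k := by
    intro k
    induction k with
    | zero => simp
    | succ k ih =>
      intro hk
      rw [pow_succ', Equiv.Perm.mul_apply, coe_finRotate_of_ne_last, ih (by omega)]
      intro h
      have := ih (by omega)
      rw [h, Fin.val_last] at this
      omega
  exact Fin.ext (h x.val (by have := x.2; omega))

theorem card_cyc [Fintype (cyc n)] : Fintype.card (cyc n) = n := by
  rw [← Nat.card_eq_fintype_card, Nat.card_zpowers]
  obtain ⟨r, rfl⟩ := Nat.exists_eq_succ_of_ne_zero (NeZero.ne n)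
  rcases r with _ | r
  · simp
    rfl
  · rw [isCycle_finRotate.orderOf, support_finRotate, Finset.card_univ, Fintype.card_fin]

omit [NeZero n] in
theorem exists_cycGen_pow (g : cyc n) : ∃ k : ℕ, cycGen n ^ k = g := by
  obtain ⟨k, hk⟩ := (isOfFinOrder_of_finite _).mem_powers_iff_mem_zpowers.2 g.2
  exact ⟨k, Subtype.ext hk⟩

/-- Roots of unity define linear characters of the cyclic groups. -/
theorem exists_cyc_character {ζ : F} (hζ : ζ ^ n = 1) : ∃ χ : cyc n →* F, χ (cycGen n) = ζ := by
  obtain ⟨r, rfl⟩ := Nat.exists_eq_succ_of_ne_zero (NeZero.ne n)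
  -- The character is g ↦ ζ^(g 0): the k-th power of the generator sends 0 to k modulo n, and ζ^n =
  -- 1.
  have h : ∀ k : ℕ, ζ ^ (((cycGen (r + 1) ^ k : cyc (r + 1)) : Equiv.Perm (Fin (r + 1))) 0).val =
      ζ ^ k := by
    intro k
    induction k with
    | zero => simp
    | succ k ih =>
      have h1 : ((cycGen (r + 1) ^ (k + 1) : cyc (r + 1)) : Equiv.Perm (Fin (r + 1))) 0 =
          ((cycGen (r + 1) ^ k : cyc (r + 1)) : Equiv.Perm (Fin (r + 1))) 0 + 1 := by
        rw [pow_succ']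
        exact finRotate_apply _
      rw [h1, Fin.val_add, ← pow_eq_pow_mod _ hζ, pow_add, ih, pow_succ]
      congr 1
      rw [Fin.val_one', ← pow_eq_pow_mod _ hζ, pow_one]
  let χ : cyc (r + 1) →* F :=
    { toFun := fun g => ζ ^ ((g : Equiv.Perm (Fin (r + 1))) 0).val
      map_one' := by simp
      map_mul' := fun g g' => by
        obtain ⟨k, rfl⟩ := exists_cycGen_pow g
        obtain ⟨l, rfl⟩ := exists_cycGen_pow g'
        rw [← pow_add, h, h, h, pow_add] }
  exact ⟨χ, by simpa [χ] using h 1⟩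

section Root

variable [Fintype (cyc n)] {δ : cyc n →* F}

/-- The element of `F[S_n]` that generates the module induced from a character of `C_n`. -/
def cycSum (δ : cyc n →* F) : MonoidAlgebra F (Equiv.Perm (Fin n)) :=
  mapDomainRingHom F (cyc n).subtype (charSum δ)

theorem cycSum_mul_of_equivariant {y : MonoidAlgebra F (Equiv.Perm (Fin n))}
    (h : of F _ (finRotate n) * y = δ (cycGen n) • y) : cycSum δ * y = (n : F) • y := by
  have key : cycSum δ * y = (Fintype.card (cyc n) : F) • y := by
    refine charSum_mul_of_equivariant fun g => ?_
    obtain ⟨k, rfl⟩ := exists_cycGen_pow g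
    rw [map_pow, map_pow, map_pow]
    change of F _ (finRotate n) ^ k * y = _
    induction k with
    | zero => simp
    | succ k ih => rw [pow_succ', mul_assoc, ih, mul_smul_comm, h, smul_smul, ← pow_succ]
  rwa [card_cyc] at key

omit [NeZero n] in
theorem of_mul_cycSum (g : cyc n) :
    of F _ (g : Equiv.Perm (Fin n)) * cycSum δ = δ g • cycSum δ := by
  have h := congrArg (mapDomainRingHom F (cyc n).subtype) (of_mul_charSum δ g)
  rw [map_mul] at h
  refine Eq.trans ?_ (h.trans (mapDomain_smul _ _ _))
  simp [cycSum]

theorem cycSum_mul_cycSum : cycSum δ * cycSum δ = (n : F) • cycSum δ :=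
  cycSum_mul_of_equivariant (of_mul_cycSum (cycGen n))

/-- The element κ is the sum of ζ^maj(τ) τ. The constant c is the product of 1 - ζ^i over 0 < i < n,
which is nonzero exactly because ζ is primitive. -/
theorem exists_klyachko (hδ : IsPrimitiveRoot (δ (cycGen n)) n) :
    ∃ κ : MonoidAlgebra F (Equiv.Perm (Fin n)), cycSum δ * κ = (n : F) • κ ∧
      ∃ c : F, c ≠ 0 ∧ omega F n * κ = c • omega F n := by
  obtain ⟨r, rfl⟩ := Nat.exists_eq_succ_of_ne_zero (NeZero.ne n)
  set ζ := δ (cycGen (r + 1)) with hζ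
  refine ⟨descentSum (fun i => ζ ^ (i.val + 1)) 1, cycSum_mul_of_equivariant ?_, _, ?_,
    omega_mul_descentSum _ _⟩
  · refine coeff_injective (Finsupp.ext fun τ => ?_)
    obtain ⟨τ, rfl⟩ := (Equiv.mulLeft (finRotate (r + 1))).surjective τ
    rw [of_apply, coeff_single_mul_apply, one_mul, Equiv.coe_mulLeft, inv_mul_cancel_left,
      coeff_smul_apply, coeff_descentSum, coeff_descentSum, smul_eq_mul, ← hζ]
    have h1 := prod_cyclic_finRotate hδ.pow_eq_one τ
    rw [← prod_descent_eq_prod_cyclic, ← prod_descent_eq_prod_cyclic] at h1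
    convert h1.symm <;> rfl
  · rw [Finset.prod_ne_zero_iff]
    intro i _ h
    rw [Pi.one_apply, sub_eq_zero] at h
    have := Nat.le_of_dvd (Nat.succ_pos _) (hδ.dvd_of_pow_eq_one _ h.symm)
    have := i.2
    omega

/-- C_n is transitive on the letters, so every τ can be corrected on the right by an element of C_n
to fix 0, at the cost of a scalar. The translates by the stabiliser of 0 therefore span. -/
theorem finrank_span_cycSum_le : finrank F ((Ideal.span {cycSum δ}).restrictScalars F) ≤
    Nat.card {σ : Equiv.Perm (Fin n) // σ 0 = 0} := by
  classical
  rw [Nat.card_eq_fintype_card]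
  refine le_trans (Submodule.finrank_mono ?_)
    (finrank_range_le_card (R := F)
      fun σ : {σ : Equiv.Perm (Fin n) // σ 0 = 0} => of F _ σ.1 * cycSum δ)
  intro y hy
  obtain ⟨a, rfl⟩ := Ideal.mem_span_singleton'.1 hy
  induction a using MonoidAlgebra.induction_on with
  | of τ =>
    obtain ⟨g, hg⟩ := exists_cyc_apply_zero (τ⁻¹ 0)
    have h1 : of F _ τ * cycSum δ = δ g⁻¹ • (of F _ (τ * (g : Equiv.Perm (Fin n))) * cycSum δ) := by
      rw [map_mul, mul_assoc, of_mul_cycSum, mul_smul_comm, smul_smul, ← map_mul, inv_mul_cancel,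
        map_one, one_smul]
    rw [h1]
    refine Submodule.smul_mem _ _ (Submodule.subset_span ⟨⟨_, ?_⟩, rfl⟩)
    simp [hg]
  | add a b ha hb =>
    rw [add_mul]
    exact add_mem (ha (Ideal.mul_mem_left _ _ (Ideal.mem_span_singleton_self _)))
      (hb (Ideal.mul_mem_left _ _ (Ideal.mem_span_singleton_self _)))
  | smul c a ha =>
    rw [smul_mul_assoc]
    exact Submodule.smul_mem _ _
      (ha (Ideal.mul_mem_left _ _ (Ideal.mem_span_singleton_self _)))

omit [Fintype (cyc n)] in
-- Among the permutations fixing 0, only the identity occurs in ω. Hence the translates of ω by this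
-- stabiliser have the identity as their coefficient matrix there.
theorem le_finrank_span_omega : Nat.card {σ : Equiv.Perm (Fin n) // σ 0 = 0} ≤
    finrank F ((Ideal.span {omega F n}).restrictScalars F) := by
  classical
  rw [Nat.card_eq_fintype_card]
  let f : {σ : Equiv.Perm (Fin n) // σ 0 = 0} → (Ideal.span {omega F n}).restrictScalars F :=
    fun σ => ⟨of F _ σ.1 * omega F n, Ideal.mul_mem_left _ _ (Ideal.mem_span_singleton_self _)⟩
  have hf : LinearIndependent F f := by
    rw [Fintype.linearIndependent_iff]
    intro c hc τ
    have h1 := congrArg (fun y : (Ideal.span {omega F n}).restrictScalars F =>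
      (y : MonoidAlgebra F (Equiv.Perm (Fin n))).coeff τ.1) hc
    have h2 : ∀ σ : {σ : Equiv.Perm (Fin n) // σ 0 = 0},
        (of F _ σ.1 * omega F n).coeff τ.1 = if σ = τ then 1 else 0 := by
      intro σ
      have h3 : (σ.1⁻¹ * τ.1) 0 = 0 := by
        rw [Equiv.Perm.mul_apply, τ.2, Equiv.Perm.inv_eq_iff_eq, σ.2]
      rw [of_apply, coeff_single_mul_apply, one_mul, coeff_omega_of_apply_zero h3]
      refine if_congr ?_ rfl rfl
      rw [inv_mul_eq_one, Subtype.ext_iff]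
    simpa [f, coeff_sum, Finsupp.finsetSum_apply, coeff_smul_apply, h2, -of_apply] using h1
  exact hf.fintype_card_le_finrank

/-- Multiplying further by Klyachko's element κ returns n c y, and both scalars are nonzero. -/
theorem eq_zero_of_mul_cycSum (hδ : IsPrimitiveRoot (δ (cycGen n)) n)
    {y : MonoidAlgebra F (Equiv.Perm (Fin n))} (hy : y ∈ Ideal.span {omega F n})
    (h : y * cycSum δ = 0) : y = 0 := by
  obtain ⟨κ, h1, c, hc, h2⟩ := exists_klyachko hδ
  obtain ⟨a, rfl⟩ := Ideal.mem_span_singleton'.1 hy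
  have hn : (n : F) ≠ 0 := hδ.neZero'.out
  have h3 : (n : F) • (c • (a * omega F n)) = 0 := by
    rw [← mul_smul_comm c, ← h2, ← mul_assoc, ← mul_smul_comm, ← h1, ← mul_assoc, h, zero_mul]
  exact (smul_eq_zero_iff_right hc).1 ((smul_eq_zero_iff_right hn).1 h3)

/-- Klyachko's theorem: `Lie_F(n)` is isomorphic to the module induced from a faithful character
of `C_n`. -/
theorem exists_omega_cycSum_inverse (hδ : IsPrimitiveRoot (δ (cycGen n)) n) :
    ∃ u v : MonoidAlgebra F (Equiv.Perm (Fin n)),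
      omega F n * u ∈ Ideal.span {cycSum δ} ∧ cycSum δ * v ∈ Ideal.span {omega F n} ∧
      omega F n * u * v = omega F n ∧ cycSum δ * v * u = cycSum δ := by
  have hn : (n : F) ≠ 0 := hδ.neZero'.out
  set W := (Ideal.span {omega F n}).restrictScalars F
  set E := (Ideal.span {cycSum δ}).restrictScalars F
  let f : W →ₗ[F] E := (LinearMap.mulRight F (cycSum δ)).restrict fun y _ =>
    Ideal.mul_mem_left _ y (Ideal.mem_span_singleton_self _)
  have hf : Function.Injective f := by
    rw [injective_iff_map_eq_zero]
    exact fun y hy => Subtype.ext (eq_zero_of_mul_cycSum hδ y.2 (congrArg Subtype.val hy))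
  have hfr : finrank F W = finrank F E :=
    le_antisymm (LinearMap.finrank_le_finrank_of_injective hf)
      (finrank_span_cycSum_le.trans le_finrank_span_omega)
  -- Right multiplication by the character sum ε is bijective from the ideal of ω to that of ε. The
  -- preimage P of ε provides the inverse: with u = ε / n and v = P, both identities follow from P ε
  -- = ε and ε ε = n ε, the first after cancelling ε.
  obtain ⟨P, hP⟩ := (LinearMap.injective_iff_surjective_of_finrank_eq_finrank hfr).1 hf
    ⟨cycSum δ, Ideal.mem_span_singleton_self _⟩
  have hP' : (P : MonoidAlgebra F (Equiv.Perm (Fin n))) * cycSum δ = cycSum δ :=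
    congrArg Subtype.val hP
  refine ⟨(n : F)⁻¹ • cycSum δ, P, ?_, Ideal.mul_mem_left _ _ P.2, ?_, ?_⟩
  · rw [mul_smul_comm]
    exact Submodule.smul_of_tower_mem _ _
      (Ideal.mul_mem_left _ _ (Ideal.mem_span_singleton_self _))
  · rw [← sub_eq_zero]
    refine eq_zero_of_mul_cycSum hδ (sub_mem (Ideal.mul_mem_left _ _ P.2)
      (Ideal.mem_span_singleton_self _)) ?_
    rw [sub_mul, mul_assoc, hP', mul_smul_comm, smul_mul_assoc, mul_assoc, cycSum_mul_cycSum,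
      mul_smul_comm, smul_smul, inv_mul_cancel₀ hn, one_smul, sub_self]
  · rw [mul_assoc, mul_smul_comm, hP', mul_smul_comm, cycSum_mul_cycSum, smul_smul,
      inv_mul_cancel₀ hn, one_smul]

end Root

end Klyachko

/-! ### Cancellation in ω^q Ξ^q -/

section BlockMonotone

variable {n : ℕ} {κ : Type} {b : Fin n → κ}

/-- `σ` is increasing on each block. -/
def BlockMono (b : Fin n → κ) (σ : Equiv.Perm (Fin n)) : Prop :=
  ∀ x y, x < y → b x = b y → σ x < σ y

/-- The permutations that map each block monotonically onto a block. -/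
def blockMonoGroup (b : Fin n → κ) : Subgroup (Equiv.Perm (Fin n)) where
  carrier := {π | BlockMono b π ∧ ∀ x y, b (π x) = b (π y) ↔ b x = b y}
  one_mem' := ⟨fun _ _ h _ => h, fun _ _ => Iff.rfl⟩
  mul_mem' := fun {π ρ} hπ hρ =>
    ⟨fun x y h hb => hπ.1 _ _ (hρ.1 x y h hb) ((hρ.2 x y).2 hb),
      fun x y => (hπ.2 _ _).trans (hρ.2 x y)⟩
  inv_mem' := fun {π} hπ => by
    have h : ∀ x y, b (π⁻¹ x) = b (π⁻¹ y) ↔ b x = b y := fun x y => by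
      simpa using (hπ.2 (π⁻¹ x) (π⁻¹ y)).symm
    refine ⟨fun x y hxy hb => ?_, h⟩
    by_contra! h'
    rcases h'.lt_or_eq with h' | h'
    · have := hπ.1 _ _ h' ((h y x).2 hb.symm)
      simp at this
      exact lt_asymm hxy this
    · exact hxy.ne (π⁻¹.injective h').symm

theorem mem_blockMonoGroup {π : Equiv.Perm (Fin n)} :
    π ∈ blockMonoGroup b ↔ BlockMono b π ∧ ∀ x y, b (π x) = b (π y) ↔ b x = b y := Iff.rfl

theorem BlockMono.mul {σ π : Equiv.Perm (Fin n)} (hσ : BlockMono b σ)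
    (hπ : π ∈ blockMonoGroup b) : BlockMono b (σ * π) :=
  fun x y h hb => hσ _ _ (hπ.1 x y h hb) ((hπ.2 x y).2 hb)

variable {F : Type u} [Field F]

open Classical in
/-- The sum of the elements of a subset of a finite group. -/
def setSum (F : Type u) [Field F] {G : Type} [Group G] [Fintype G] (S : Set G) :
    MonoidAlgebra F G :=
  ∑ g with g ∈ S, of F G g

open Classical in
theorem coeff_setSum {G : Type} [Group G] [Fintype G] (S : Set G) (g : G) :
    (setSum F S).coeff g = if g ∈ S then 1 else 0 := by
  simp [setSum, coeff_sum, Finsupp.finsetSum_apply, coeff_single, Finsupp.single_apply]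

/-- A union of left cosets of `K` is a left multiple of the sum of `K`. -/
theorem setSum_mem_span {G : Type} [Group G] [Fintype G] (K : Subgroup G) {S : Set G}
    (h : ∀ g ∈ S, ∀ k ∈ K, g * k ∈ S) :
    setSum F S ∈ Ideal.span {setSum F (K : Set G)} := by
  classical
  refine Ideal.mem_span_singleton'.2
    ⟨∑ t : G ⧸ K with t.out ∈ S, of F G t.out, coeff_injective (Finsupp.ext fun g => ?_)⟩
  have h1 : ∀ t : G ⧸ K, (t.out⁻¹ * g ∈ K ↔ t = g) := fun t => by
    rw [← QuotientGroup.eq, QuotientGroup.out_eq']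
  have h2 : ((g : G ⧸ K).out ∈ S ↔ g ∈ S) := by
    have h3 := (h1 g).2 rfl
    constructor
    · intro h4
      simpa using h _ h4 _ h3
    · intro h4
      simpa using h _ h4 _ (K.inv_mem h3)
  rw [coeff_setSum, Finset.sum_mul, coeff_sum, Finsupp.finsetSum_apply]
  simp only [of_apply, coeff_single_mul_apply, one_mul, coeff_setSum, SetLike.mem_coe, h1]
  rw [Finset.sum_ite_eq']
  simp [h2]

variable [LinearOrder κ] {c : Fin n → Equiv.Perm (Fin n)} {l : List (Fin n)}

/-- If `τ⁻¹` separates letters of some block, then the signs cancel. -/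
theorem exists_toggle (hb : Monotone b) (hc : IsCycleFamily b c) (hl : l.Pairwise (· < ·))
    (hl' : ∀ x, x ∈ l ↔ ∃ y < x, b y = b x) {τ : Equiv.Perm (Fin n)} {u v : Fin n}
    (huv : b u = b v) (hτ : b (τ⁻¹ u) ≠ b (τ⁻¹ v)) :
    ∃ m ∈ l, ∀ A, BlockMono b ((cycleProd c (insert m A) l)⁻¹ * τ) ↔
      BlockMono b ((cycleProd c A l)⁻¹ * τ) := by
  classical
  let S : Finset (Fin n) :=
    Finset.univ.filter fun z => ∃ y < z, b y = b z ∧ b (τ⁻¹ y) ≠ b (τ⁻¹ z)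
  have hS : S.Nonempty := by
    rcases lt_trichotomy u v with h | rfl | h
    · exact ⟨v, Finset.mem_filter.2 ⟨Finset.mem_univ _, u, h, huv, hτ⟩⟩
    · exact absurd rfl hτ
    · exact ⟨u, Finset.mem_filter.2 ⟨Finset.mem_univ _, v, h, huv.symm, hτ.symm⟩⟩
  set m := S.min' hS with hm
  obtain ⟨-, w, hwm, hw1, hw2⟩ := Finset.mem_filter.1 (S.min'_mem hS)
  -- Here m is the least letter separated by τ⁻¹ from a smaller letter w of its block. If some
  -- smaller y in the block were not separated from m, then y and w would be separated and the
  -- larger of them would contradict minimality.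
  have hmin : ∀ y < m, b y = b m → b (τ⁻¹ y) ≠ b (τ⁻¹ m) := by
    intro y hy hy1 hy2
    rcases lt_trichotomy y w with h | rfl | h
    · exact absurd (S.min'_le w (Finset.mem_filter.2
        ⟨Finset.mem_univ _, y, h, hy1.trans hw1.symm, fun h => hw2 (h ▸ hy2)⟩)) hwm.not_ge
    · exact hw2 hy2
    · exact absurd (S.min'_le y (Finset.mem_filter.2
        ⟨Finset.mem_univ _, w, h, hw1.trans hy1.symm, fun h => hw2 (h.trans hy2)⟩)) hy.not_ge
  refine ⟨m, (hl' m).2 ⟨w, hwm, hw1⟩, fun A => ?_⟩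
  obtain ⟨hA1, -, hA2⟩ := cycleProd_spec hc A l hl
  obtain ⟨hB1, -, hB2⟩ := cycleProd_spec hc (insert m A) l hl
  set σ := cycleProd c A l
  set σ' := cycleProd c (insert m A) l
  -- Toggling m in A affects only comparisons of m with smaller letters of its block. All these are
  -- separated by τ⁻¹, so block monotonicity of σ⁻¹ τ never uses them.
  have hlt : ∀ x y, x < y → b x = b y → b (τ⁻¹ x) = b (τ⁻¹ y) →
      (σ'⁻¹ x < σ'⁻¹ y ↔ σ⁻¹ x < σ⁻¹ y) := by
    intro x y hxy h1 h2
    have hy : y ≠ m := by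
      intro h
      rw [h] at hxy h1 h2
      exact hmin x hxy h1 h2
    rw [hA2 x y hxy h1, hB2 x y hxy h1, Finset.mem_insert]
    tauto
  have hsep : ∀ x y x' y', b x ≠ b y → b x' = b x → b y' = b y → (x' < y' ↔ b x < b y) := by
    intro x y x' y' h h1 h2
    rw [← h1, ← h2]
    rw [← h1, ← h2] at h
    exact ⟨fun h3 => lt_of_le_of_ne (hb h3.le) h, hb.reflect_lt⟩
  have key : ∀ x y, b (τ⁻¹ x) = b (τ⁻¹ y) → (σ'⁻¹ x < σ'⁻¹ y ↔ σ⁻¹ x < σ⁻¹ y) := by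
    intro x y h
    by_cases h1 : b x = b y
    · rcases lt_trichotomy x y with h2 | rfl | h2
      · exact hlt x y h2 h1 h
      · simp
      · have h3 := hlt y x h2 h1.symm h.symm
        rw [← not_iff_not, not_lt, not_lt, (σ'⁻¹.injective.ne h2.ne).le_iff_lt,
          (σ⁻¹.injective.ne h2.ne).le_iff_lt, h3]
    · rw [hsep x y _ _ h1 (hA1 x) (hA1 y), hsep x y _ _ h1 (hB1 x) (hB1 y)]
  refine forall₄_congr fun x y _ hbxy => ?_
  exact key (τ x) (τ y) (by simpa using hbxy)

/-- Coefficients are compared at τ. If τ⁻¹ separates letters of a block, toggling m cancels both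
sums. Otherwise τ permutes the blocks, and then a block-monotone σ_A⁻¹ τ automatically lies in the
group, so the sums agree term by term. -/
theorem list_prod_mul_setSum (hb : Monotone b) (hc : IsCycleFamily b c) (hl : l.Pairwise (· < ·))
    (hl' : ∀ x, x ∈ l ↔ ∃ y < x, b y = b x) :
    (l.map fun i => 1 - of F (Equiv.Perm (Fin n)) (c i)⁻¹).prod * setSum F {σ | BlockMono b σ} =
      (l.map fun i => 1 - of F (Equiv.Perm (Fin n)) (c i)⁻¹).prod *
        setSum F (blockMonoGroup b : Set (Equiv.Perm (Fin n))) := by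
  classical
  rw [list_prod_one_sub_of c (hl.imp fun h => h.ne)]
  refine coeff_injective (Finsupp.ext fun τ => ?_)
  simp only [Finset.sum_mul, coeff_sum, Finsupp.finsetSum_apply, smul_mul_assoc, coeff_smul_apply,
    of_apply, coeff_single_mul_apply, one_mul, coeff_setSum, smul_eq_mul]
  rw [← sub_eq_zero, ← Finset.sum_sub_distrib]
  simp only [← mul_sub]
  have hK : ∀ A, ∀ x y, (b (((cycleProd c A l)⁻¹ * τ) x) = b (((cycleProd c A l)⁻¹ * τ) y) ↔
      b (τ x) = b (τ y)) := fun A x y => by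
    simp only [Equiv.Perm.mul_apply, (cycleProd_spec hc A l hl).1]
  by_cases h : ∃ u v, b u = b v ∧ b (τ⁻¹ u) ≠ b (τ⁻¹ v)
  · obtain ⟨u, v, huv, hτ⟩ := h
    obtain ⟨m, hm, h⟩ := exists_toggle hb hc hl hl' huv hτ
    refine sum_powerset_neg_one_pow_eq_zero (List.mem_toFinset.2 hm) _ fun A _ _ => ?_
    simp only [Set.mem_ofPred_eq, SetLike.mem_coe, mem_blockMonoGroup, h, hK]
  · push Not at h
    have h1 : ∀ x y, b (τ x) = b (τ y) ↔ b x = b y := by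
      let N : Submonoid (Equiv.Perm (Fin n)) :=
        { carrier := {ρ | ∀ x y, b x = b y → b (ρ x) = b (ρ y)}
          one_mem' := fun _ _ h => h
          mul_mem' := fun h1 h2 x y h => h1 _ _ (h2 x y h) }
      -- Only τ⁻¹ is known to respect blocks; by finite order τ is a power of it.
      have h2 : τ ∈ N := by
        obtain ⟨k, hk⟩ := (isOfFinOrder_of_finite τ⁻¹).mem_powers_iff_mem_zpowers.2
          (show τ ∈ Subgroup.zpowers τ⁻¹ from by simp)
        exact hk ▸ N.pow_mem (show τ⁻¹ ∈ N from h) k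
      exact fun x y => ⟨fun h3 => by simpa using h _ _ h3, h2 x y⟩
    refine Finset.sum_eq_zero fun A _ => ?_
    simp only [Set.mem_ofPred_eq, SetLike.mem_coe, mem_blockMonoGroup, hK, h1]
    simp

end BlockMonotone

/-! ### Descents and Lie elements on the consecutive intervals of q -/

section Composition

variable {n : ℕ} (q : Composition n)

theorem embedding_lt_embedding {j k : Fin q.length} (h : j < k) (x : Fin (q.blocksFun j))
    (y : Fin (q.blocksFun k)) : q.embedding j x < q.embedding k y := by
  rw [Fin.lt_def, q.coe_embedding, q.coe_embedding]
  have h1 := q.monotone_sizeUpTo (show j.val + 1 ≤ k.val from h)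
  have h2 := q.sizeUpTo_succ' j
  have := x.2
  omega

theorem index_monotone : Monotone q.index := by
  intro x y h
  by_contra! h'
  have := embedding_lt_embedding q h' (q.invEmbedding y) (q.invEmbedding x)
  rw [q.embedding_comp_inv, q.embedding_comp_inv] at this
  exact absurd h this.not_ge

theorem exists_eq_embedding (x : Fin n) : ∃ j y, x = q.embedding j y :=
  ⟨_, _, (q.embedding_comp_inv x).symm⟩

/-- The permutation that rotates the initial segment ending at `x` of the block of `x`. -/
def blockRotation (x : Fin n) : Equiv.Perm (Fin n) :=
  Equiv.Perm.viaEmbeddingHom (q.embedding (q.blocksFinEquiv.symm x).1).toEmbedding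
    (Fin.cycleRange (q.blocksFinEquiv.symm x).2)

theorem blockRotation_embedding (j : Fin q.length) (y : Fin (q.blocksFun j)) :
    blockRotation q (q.embedding j y) =
      Equiv.Perm.viaEmbeddingHom (q.embedding j).toEmbedding (Fin.cycleRange y) := by
  have h : q.embedding j y = q.blocksFinEquiv ⟨j, y⟩ := rfl
  rw [blockRotation, h, Equiv.symm_apply_apply]

theorem blockRotation_apply_same (j : Fin q.length) (y z : Fin (q.blocksFun j)) :
    blockRotation q (q.embedding j y) (q.embedding j z) = q.embedding j (Fin.cycleRange y z) := by
  rw [blockRotation_embedding]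
  exact Equiv.Perm.viaEmbedding_apply _ (q.embedding j).toEmbedding z

theorem blockRotation_apply_of_ne {j k : Fin q.length} (h : k ≠ j) (y : Fin (q.blocksFun j))
    (z : Fin (q.blocksFun k)) :
    blockRotation q (q.embedding j y) (q.embedding k z) = q.embedding k z := by
  rw [blockRotation_embedding]
  refine Equiv.Perm.viaEmbedding_apply_of_notMem _ (q.embedding j).toEmbedding _ ?_
  intro h'
  exact h ((q.index_embedding k z).symm.trans (q.mem_range_embedding_iff'.1 h').symm)

theorem isCycleFamily_blockRotation : IsCycleFamily q.index (blockRotation q) where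
  block i x := by
    obtain ⟨j, y, rfl⟩ := exists_eq_embedding q i
    obtain ⟨k, z, rfl⟩ := exists_eq_embedding q x
    by_cases h : k = j
    · subst h
      rw [blockRotation_apply_same, q.index_embedding, q.index_embedding]
    · rw [blockRotation_apply_of_ne q h]
  fix i x hix := by
    obtain ⟨j, y, rfl⟩ := exists_eq_embedding q i
    obtain ⟨k, z, rfl⟩ := exists_eq_embedding q x
    by_cases h : k = j
    · subst h
      rw [blockRotation_apply_same, Fin.cycleRange_of_gt ((q.embedding k).lt_iff_lt.1 hix)]
    · rw [blockRotation_apply_of_ne q h]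
  mono i x x' hx hi hb := by
    obtain ⟨j, y, rfl⟩ := exists_eq_embedding q i
    obtain ⟨k, z, rfl⟩ := exists_eq_embedding q x
    obtain ⟨k', z', rfl⟩ := exists_eq_embedding q x'
    rw [q.index_embedding, q.index_embedding] at hb
    subst hb
    by_cases h : k = j
    · subst h
      rw [blockRotation_apply_same, blockRotation_apply_same, (q.embedding k).lt_iff_lt]
      rw [(q.embedding k).lt_iff_lt] at hx hi
      exact (isCycleFamily_cycleRange _).mono y z z' hx hi rfl
    · rwa [blockRotation_apply_of_ne q h, blockRotation_apply_of_ne q h]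
  first i x hx hb := by
    obtain ⟨j, y, rfl⟩ := exists_eq_embedding q i
    obtain ⟨k, z, rfl⟩ := exists_eq_embedding q x
    rw [q.index_embedding, q.index_embedding] at hb
    subst hb
    rw [blockRotation_apply_same, blockRotation_apply_same, (q.embedding k).lt_iff_lt]
    exact (isCycleFamily_cycleRange _).first y z ((q.embedding k).lt_iff_lt.1 hx) rfl

/-- Concatenated over the intervals, the factors of the ω's have increasing indices, omitting just
the first letter of each interval. This is the ordering required for the signed expansion. -/
theorem exists_omegaUpper_eq (F : Type u) [Field F] : ∃ l : List (Fin n),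
    omegaUpper F q = (l.map fun i => 1 - of F (Equiv.Perm (Fin n)) (blockRotation q i)⁻¹).prod ∧
    l.Pairwise (· < ·) ∧ ∀ x, x ∈ l ↔ ∃ y < x, q.index y = q.index x := by
  refine ⟨(List.ofFn fun j => ((List.finRange (q.blocksFun j)).filter fun i => i.val ≠ 0).map
    (q.embedding j)).flatten, ?_, ?_, fun x => ?_⟩
  · rw [omegaUpper, List.map_flatten, List.prod_flatten, List.map_map, List.map_ofFn]
    congr 2
    funext j
    rw [omega, map_list_prod, List.map_map, Function.comp_apply, Function.comp_apply,
      List.map_map]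
    congr 2
    funext i
    rw [Function.comp_apply, map_sub, map_one, Function.comp_apply, blockRotation_embedding,
      ← map_inv]
    congr 1
    exact mapDomain_single
  · rw [List.pairwise_flatten]
    constructor
    · intro l hl
      obtain ⟨j, rfl⟩ := List.mem_ofFn.1 hl
      exact ((List.pairwise_lt_finRange _).filter _).map _ fun x y h =>
        (q.embedding j).lt_iff_lt.2 h
    · rw [List.pairwise_ofFn]
      intro j k h x hx y hy
      obtain ⟨x, -, rfl⟩ := List.mem_map.1 hx
      obtain ⟨y, -, rfl⟩ := List.mem_map.1 hy
      exact embedding_lt_embedding q h x y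
  · simp only [List.mem_flatten, List.mem_ofFn, exists_exists_eq_and, List.mem_map,
      List.mem_filter, List.mem_finRange, true_and, decide_eq_true_eq]
    constructor
    · rintro ⟨j, z, hz, rfl⟩
      refine ⟨q.embedding j ⟨0, by omega⟩, (q.embedding j).lt_iff_lt.2 ?_, ?_⟩
      · exact Nat.pos_of_ne_zero hz
      · rw [q.index_embedding, q.index_embedding]
    · rintro ⟨y, hy, h⟩
      obtain ⟨j, z, rfl⟩ := exists_eq_embedding q x
      obtain ⟨k, w, rfl⟩ := exists_eq_embedding q y
      rw [q.index_embedding, q.index_embedding] at h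
      subst h
      have := Fin.lt_def.1 ((q.embedding k).lt_iff_lt.1 hy)
      exact ⟨k, z, by omega, rfl⟩

/-- Monotonicity on an interval is checked on adjacent positions, and a one-based position i
compares the letters i - 1 and i, which lie in different intervals exactly when i is a partial sum.
-/
theorem descents_iff_blockMono (σ : Equiv.Perm (Fin n)) :
    (∀ i, IsDescent σ i → ∃ j, 1 ≤ j ∧ j ≤ q.length ∧ i = q.sizeUpTo j) ↔
      BlockMono q.index σ := by
  constructor
  · intro h x y hxy hb
    have key : ∀ d, ∀ h : x.val + d < n, 0 < d → q.index x = q.index ⟨x.val + d, h⟩ →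
        σ x < σ ⟨x.val + d, h⟩ := by
      intro d
      induction d with
      | zero => intro _ h0; exact absurd h0 (lt_irrefl 0)
      | succ d ih =>
        intro hd _ hb
        have hle : q.index x = q.index ⟨x.val + d, by omega⟩ :=
          le_antisymm (index_monotone q (Fin.le_def.2 (Nat.le_add_right _ _)))
            (hb ▸ index_monotone q (Fin.le_def.2 (by simp)))
        have hstep : σ ⟨x.val + d, by omega⟩ < σ ⟨x.val + (d + 1), hd⟩ := by
          by_contra! h'
          have h'' : σ ⟨x.val + (d + 1), hd⟩ < σ ⟨x.val + d, by omega⟩ :=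
            lt_of_le_of_ne h' (σ.injective.ne (by simp [Fin.ext_iff]))
          obtain ⟨j, -, -, hj⟩ := h (x.val + (d + 1)) ⟨by omega, hd, h''⟩
          have h1 := q.sizeUpTo_index_le x
          have h2 := q.lt_sizeUpTo_index_succ ⟨x.val + (d + 1), hd⟩
          rw [← hb, Fin.val_succ, Fin.val_mk, hj] at h2
          have h3 := q.monotone_sizeUpTo.reflect_lt h2
          have h4 : q.sizeUpTo (q.index x) < q.sizeUpTo j := by omega
          have h5 := q.monotone_sizeUpTo.reflect_lt h4
          omega
        rcases d.eq_zero_or_pos with rfl | hd0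
        · exact hstep
        · exact (ih (by omega) hd0 hle).trans hstep
    have hxy' := Fin.lt_def.1 hxy
    have e : (⟨x.val + (y.val - x.val), by omega⟩ : Fin n) = y := Fin.ext (by simp; omega)
    have := key (y.val - x.val) (by omega) (by omega) (by rw [e, hb])
    rwa [e] at this
  · rintro h i ⟨hi0, hi, hd⟩
    have hne : q.index ⟨i - 1, by omega⟩ ≠ q.index ⟨i, hi⟩ := fun h' =>
      lt_asymm hd (h _ _ (Fin.lt_def.2 (by simp; omega)) h')
    have hlt : q.index ⟨i - 1, by omega⟩ < q.index ⟨i, hi⟩ :=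
      lt_of_le_of_ne (index_monotone q (Fin.le_def.2 (by simp))) hne
    refine ⟨q.index ⟨i, hi⟩, ?_, (q.index ⟨i, hi⟩).2.le, ?_⟩
    · have := Fin.lt_def.1 hlt
      omega
    · have h1 := q.sizeUpTo_index_le ⟨i, hi⟩
      have h2 := q.lt_sizeUpTo_index_succ ⟨i - 1, by omega⟩
      have h3 := q.monotone_sizeUpTo (show (q.index ⟨i - 1, by omega⟩).val + 1 ≤ _ from hlt)
      simp only [Fin.val_succ] at h1 h2
      omega

variable (F : Type u) [Field F]

theorem solomon_eq_setSum : solomon F q = setSum F {σ | BlockMono q.index σ} := by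
  classical
  rw [solomon, setSum]
  refine Finset.sum_congr ?_ fun _ _ => rfl
  ext σ
  simp only [Finset.mem_filter, Finset.mem_univ, true_and, descents_iff_blockMono]
  rfl

theorem solomon_mem_span :
    solomon F q ∈ Ideal.span {setSum F (blockMonoGroup q.index : Set (Equiv.Perm (Fin n)))} := by
  rw [solomon_eq_setSum]
  exact setSum_mem_span _ fun σ hσ π hπ => BlockMono.mul hσ hπ

theorem omegaUpper_mul_solomon :
    omegaUpper F q * solomon F q = omegaUpper F q *
      setSum F (blockMonoGroup q.index : Set (Equiv.Perm (Fin n))) := by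
  obtain ⟨l, h1, h2, h3⟩ := exists_omegaUpper_eq q F
  rw [h1, solomon_eq_setSum]
  exact list_prod_mul_setSum (index_monotone q) (isCycleFamily_blockRotation q) h2 h3

end Composition

/-! ### Blocks of equal length matched with the intervals of q -/

section Matching

variable {n : ℕ} {q : Composition n}

theorem card_blocksFun_eq (q : Composition n) (i : ℕ) :
    Fintype.card {j // q.blocksFun j = i} = mult q i := by
  rw [Fintype.card_subtype]
  exact (Fin.card_filter_univ_eq_vector_get_eq_count i
    (⟨q.blocks, rfl⟩ : List.Vector ℕ q.blocks.length))

/-- The parts of `q` correspond to the blocks of equal letters. -/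
theorem exists_blocks_equiv (q : Composition n) :
    ∃ θ : (Σ i : Finset.Icc 1 n, Fin (mult q i)) ≃ Fin q.length,
      ∀ s, q.blocksFun (θ s) = s.1 := by
  classical
  let f : Fin q.length → Finset.Icc 1 n := fun j =>
    ⟨q.blocksFun j, Finset.mem_Icc.2 ⟨q.one_le_blocksFun j, q.blocksFun_le j⟩⟩
  have h : ∀ i : Finset.Icc 1 n, Nonempty (Fin (mult q i) ≃ {j // f j = i}) := fun i => by
    refine ⟨(Fintype.equivFinOfCardEq ?_).symm⟩
    rw [← card_blocksFun_eq]
    exact Fintype.card_congr (Equiv.subtypeEquivRight fun j => Subtype.ext_iff)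
  let g := fun i => (h i).some
  refine ⟨(Equiv.sigmaCongrRight g).trans (Equiv.sigmaFiberEquiv f), fun s => ?_⟩
  exact congrArg Subtype.val (g s.1 s.2).2

/-- An identification of the blocks of letters with the consecutive intervals of lengths
`q_1, q_2, …`. -/
structure IsMatching (q : Composition n) (e : Letters q ≃ Fin n)
    (θ : (Σ i : Finset.Icc 1 n, Fin (mult q i)) ≃ Fin q.length) : Prop where
  length : ∀ s, q.blocksFun (θ s) = s.1
  apply : ∀ s x, e ⟨s.1, s.2, x⟩ = q.embedding (θ s) (Fin.cast (length s).symm x)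

theorem exists_isMatching (q : Composition n) : ∃ e θ, IsMatching q e θ := by
  obtain ⟨θ, hθ⟩ := exists_blocks_equiv q
  let f : Letters q → Fin n := fun y =>
    q.embedding (θ ⟨y.1, y.2.1⟩) (Fin.cast (hθ ⟨y.1, y.2.1⟩).symm y.2.2)
  have hf : Function.Injective f := by
    rintro ⟨i, k, x⟩ ⟨i', k', x'⟩ h
    have h1 := congrArg q.index h
    rw [q.index_embedding, q.index_embedding] at h1
    cases θ.injective h1
    have h2 := (q.embedding _).injective h
    rw [Fin.cast_inj] at h2
    exact congrArg _ (congrArg _ h2)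
  obtain ⟨e⟩ := nonempty_letters_equiv q
  have hf' := (Fintype.bijective_iff_injective_and_card f).2 ⟨hf, Fintype.card_congr e⟩
  exact ⟨Equiv.ofBijective f hf', θ, hθ, fun s x => rfl⟩

variable {e : Letters q ≃ Fin n} {θ : (Σ i : Finset.Icc 1 n, Fin (mult q i)) ≃ Fin q.length}

theorem IsMatching.index_apply (h : IsMatching q e θ) (i : Finset.Icc 1 n) (k : Fin (mult q i))
    (x : Fin i) : q.index (e ⟨i, k, x⟩) = θ ⟨i, k⟩ := by
  rw [h.apply ⟨i, k⟩ x, q.index_embedding]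

theorem IsMatching.lt_iff (h : IsMatching q e θ) (i : Finset.Icc 1 n) (k : Fin (mult q i))
    (x y : Fin i) : e ⟨i, k, x⟩ < e ⟨i, k, y⟩ ↔ x < y := by
  rw [h.apply ⟨i, k⟩ x, h.apply ⟨i, k⟩ y, (q.embedding _).lt_iff_lt]
  rfl

theorem IsMatching.exists_eq (h : IsMatching q e θ) {i : Finset.Icc 1 n} {k : Fin (mult q i)}
    {y : Fin n} (hy : q.index y = θ ⟨i, k⟩) : ∃ x, y = e ⟨i, k, x⟩ := by
  obtain ⟨⟨i', k', x⟩, rfl⟩ := e.surjective y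
  rw [h.index_apply] at hy
  cases θ.injective hy
  exact ⟨x, rfl⟩

theorem symmWreathPerm_apply (w : WreathProd (fun i => Equiv.Perm (Fin i)) q)
    (i : Finset.Icc 1 n) (k : Fin (mult q i)) (x : Fin i) :
    symmWreathPerm q e w (e ⟨i, k, x⟩) =
      e ⟨i, (w i).right k, (w i).left ((w i).right k) x⟩ := by
  simp [symmWreathPerm, wreathProdPerm, wreathPerm]

/-- The permutation of the blocks of equal lengths given by permutations of their indices. -/
def blockPerm (e : Letters q ≃ Fin n) (τ : ∀ i : Finset.Icc 1 n, Equiv.Perm (Fin (mult q i))) :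
    Equiv.Perm (Fin n) :=
  symmWreathPerm q e fun i => SemidirectProduct.inr (τ i)

theorem blockPerm_apply (τ : ∀ i : Finset.Icc 1 n, Equiv.Perm (Fin (mult q i)))
    (i : Finset.Icc 1 n) (k : Fin (mult q i)) (x : Fin i) :
    blockPerm e τ (e ⟨i, k, x⟩) = e ⟨i, τ i k, x⟩ :=
  symmWreathPerm_apply _ i k x

theorem blockPerm_injective (e : Letters q ≃ Fin n) : Function.Injective (blockPerm e) := by
  intro τ τ' h
  have h1 := wreathProdPerm_injective _ (fun _ => Function.injective_id) q e h
  exact funext fun i => SemidirectProduct.inr_injective (congrFun h1 i)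

theorem IsMatching.blockPerm_mem (h : IsMatching q e θ)
    (τ : ∀ i : Finset.Icc 1 n, Equiv.Perm (Fin (mult q i))) :
    blockPerm e τ ∈ blockMonoGroup q.index := by
  refine mem_blockMonoGroup.2 ⟨fun y y' hy hb => ?_, fun y y' => ?_⟩ <;>
  obtain ⟨⟨i, k, x⟩, rfl⟩ := e.surjective y <;> obtain ⟨⟨i', k', x'⟩, rfl⟩ := e.surjective y'
  · rw [h.index_apply, h.index_apply] at hb
    cases θ.injective hb
    rw [blockPerm_apply, blockPerm_apply, h.lt_iff]
    rwa [h.lt_iff] at hy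
  · rw [blockPerm_apply, blockPerm_apply, h.index_apply, h.index_apply, h.index_apply,
      h.index_apply, θ.injective.eq_iff, θ.injective.eq_iff]
    constructor
    · intro h1
      obtain ⟨rfl, h1⟩ := Sigma.mk.inj_iff.1 h1
      rw [(τ i).injective (eq_of_heq h1)]
    · intro h1
      cases h1
      rfl

/-- Since π respects the block relation in both directions, it maps a block bijectively onto a
block. The lengths then agree, and a monotone bijection between them is the identity on positions.
-/
theorem IsMatching.exists_block_image (h : IsMatching q e θ) {π : Equiv.Perm (Fin n)}
    (hπ : π ∈ blockMonoGroup q.index) (i : Finset.Icc 1 n) (k : Fin (mult q i)) :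
    ∃ k', ∀ x, π (e ⟨i, k, x⟩) = e ⟨i, k', x⟩ := by
  obtain ⟨hπ1, hπ2⟩ := mem_blockMonoGroup.1 hπ
  let x₀ : Fin i := ⟨0, (Finset.mem_Icc.1 i.2).1⟩
  obtain ⟨⟨i', k', x'⟩, hx'⟩ := e.surjective (π (e ⟨i, k, x₀⟩))
  have h0 : q.index (π (e ⟨i, k, x₀⟩)) = θ ⟨i', k'⟩ := by rw [← hx', h.index_apply]
  have h1 : ∀ x, ∃ y, π (e ⟨i, k, x⟩) = e ⟨i', k', y⟩ := fun x => h.exists_eq <| by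
    rw [← h0, hπ2, h.index_apply, h.index_apply]
  choose f hf using h1
  have hmono : StrictMono f := fun x y hxy => by
    rw [← h.lt_iff i' k', ← hf, ← hf]
    exact hπ1 _ _ ((h.lt_iff _ _ _ _).2 hxy) (by rw [h.index_apply, h.index_apply])
  have hsurj : Function.Surjective f := fun y => by
    obtain ⟨z, hz⟩ := π.surjective (e ⟨i', k', y⟩)
    have h2 : q.index z = θ ⟨i, k⟩ := by
      rw [← h.index_apply i k x₀, ← hπ2, hz, h0, h.index_apply]
    obtain ⟨x, rfl⟩ := h.exists_eq h2
    rw [hf] at hz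
    refine ⟨x, ?_⟩
    have := e.injective hz
    simpa using this
  have hi : i = i' := Subtype.ext (by
    simpa using Fintype.card_of_bijective (f := f) ⟨hmono.injective, hsurj⟩)
  subst hi
  refine ⟨k', fun x => ?_⟩
  have h3 : Equiv.ofBijective f ⟨hmono.injective, hsurj⟩ = 1 := perm_eq_one_of_strictMono hmono
  have h4 : f x = x := congrArg (fun σ : Equiv.Perm (Fin i) => σ x) h3
  rw [hf, h4]

theorem IsMatching.exists_blockPerm (h : IsMatching q e θ) {π : Equiv.Perm (Fin n)}
    (hπ : π ∈ blockMonoGroup q.index) : ∃ τ, blockPerm e τ = π := by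
  choose f hf using h.exists_block_image hπ
  have hinj : ∀ i, Function.Injective (f i) := fun i k k' hk => by
    let x₀ : Fin i := ⟨0, (Finset.mem_Icc.1 i.2).1⟩
    have h1 : π (e ⟨i, k, x₀⟩) = π (e ⟨i, k', x₀⟩) := by rw [hf, hf, hk]
    have := e.injective (π.injective h1)
    simpa using this
  refine ⟨fun i => Equiv.ofBijective (f i) (Finite.injective_iff_bijective.1 (hinj i)), ?_⟩
  ext y
  obtain ⟨⟨i, k, x⟩, rfl⟩ := e.surjective y
  rw [blockPerm_apply, hf]
  rfl

theorem blockPermSum_eq_sum (F : Type u) [Field F] (e : Letters q ≃ Fin n) :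
    blockPermSum q e F = ∑ τ : ∀ i : Finset.Icc 1 n, Equiv.Perm (Fin (mult q i)),
      of F _ (blockPerm e τ) := by
  classical
  have h1 : (fun i : Finset.Icc 1 n => blockSum F (Equiv.Perm (Fin i)) (mult q i)) =
      fun i : Finset.Icc 1 n => ∑ τ : Equiv.Perm (Fin (mult q i)),
        (1 : F) • of F (Wreath (Equiv.Perm (Fin i)) (mult q i)) (SemidirectProduct.inr τ) := by
    simp only [blockSum, one_smul]
  rw [blockPermSum, h1, piProd_sum_of, map_sum]
  refine Finset.sum_congr rfl fun τ _ => ?_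
  rw [Finset.prod_const_one, one_smul]
  exact mapDomain_single

theorem IsMatching.blockPermSum_eq (h : IsMatching q e θ) (F : Type u) [Field F] :
    blockPermSum q e F =
      setSum F (blockMonoGroup q.index : Set (Equiv.Perm (Fin n))) := by
  classical
  rw [blockPermSum_eq_sum, setSum]
  refine Finset.sum_bij (fun τ _ => blockPerm e τ) (fun τ _ => ?_)
    (fun τ _ τ' _ h => blockPerm_injective e h) (fun π hπ => ?_) fun _ _ => rfl
  · exact Finset.mem_filter.2 ⟨Finset.mem_univ _, h.blockPerm_mem τ⟩
  · obtain ⟨τ, hτ⟩ := h.exists_blockPerm (Finset.mem_filter.1 hπ).2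
    exact ⟨τ, Finset.mem_univ _, hτ⟩

/-- The embedding of the letters of a block. -/
def blockEmb (e : Letters q ≃ Fin n) (s : Σ i : Finset.Icc 1 n, Fin (mult q i)) :
    Fin s.1 ↪ Fin n where
  toFun x := e ⟨s.1, s.2, x⟩
  inj' x y h := by simpa using e.injective h

theorem list_prod_viaEmbedding_apply (e : Letters q ≃ Fin n)
    (g : ∀ s : Σ i : Finset.Icc 1 n, Fin (mult q i), Equiv.Perm (Fin s.1))
    (l : List (Σ i : Finset.Icc 1 n, Fin (mult q i))) (hl : l.Nodup) (s) (x : Fin s.1) :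
    (l.map fun t => Equiv.Perm.viaEmbeddingHom (blockEmb e t) (g t)).prod (blockEmb e s x) =
      if s ∈ l then blockEmb e s (g s x) else blockEmb e s x := by
  induction l with
  | nil => simp
  | cons t l ih =>
    obtain ⟨ht, hl⟩ := List.nodup_cons.1 hl
    have hne : t ≠ s → ∀ y, Equiv.Perm.viaEmbeddingHom (blockEmb e t) (g t) (blockEmb e s y) =
        blockEmb e s y := fun h y => by
      refine Equiv.Perm.viaEmbedding_apply_of_notMem _ _ _ ?_
      rintro ⟨z, hz⟩
      have := e.injective hz
      obtain ⟨h1, h2⟩ := Sigma.mk.inj_iff.1 this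
      obtain ⟨i, k⟩ := t
      obtain ⟨i', k'⟩ := s
      subst h1
      simp at h2
      exact h (by rw [h2.1])
    rw [List.map_cons, List.prod_cons, Equiv.Perm.mul_apply, ih hl]
    by_cases h : t = s
    · subst h
      rw [if_neg ht, if_pos List.mem_cons_self]
      exact Equiv.Perm.viaEmbedding_apply _ _ _
    · simp only [List.mem_cons, Ne.symm h, false_or]
      split_ifs <;> exact hne h _

variable {F : Type u} [Field F]

theorem list_prod_sum_smul_of {G : Type} [Group G] {N : ℕ} {H : Fin N → Type}
    [∀ j, Fintype (H j)] (c : ∀ j, H j → F) (g : ∀ j, H j → G) :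
    (List.ofFn fun j => ∑ a, c j a • of F G (g j a)).prod =
      ∑ a : ∀ j, H j, (∏ j, c j (a j)) • of F G (List.ofFn fun j => g j (a j)).prod := by
  classical
  have h1 := (MultilinearMap.mkPiAlgebraFin F N (MonoidAlgebra F G)).map_sum
    fun j a => c j a • of F G (g j a)
  simp only [MultilinearMap.mkPiAlgebraFin_apply] at h1
  rw [h1]
  refine Finset.sum_congr rfl fun a _ => ?_
  have h2 := (MultilinearMap.mkPiAlgebraFin F N (MonoidAlgebra F G)).map_smul_univ
    (fun j => c j (a j)) fun j => of F G (g j (a j))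
  simp only [MultilinearMap.mkPiAlgebraFin_apply] at h2
  rw [h2, map_list_prod, List.map_ofFn]
  rfl

theorem blockProd_eq_sum (e : Letters q ≃ Fin n) (z : ∀ i, MonoidAlgebra F (Equiv.Perm (Fin i))) :
    blockProd q e z =
      ∑ g : ∀ i : Finset.Icc 1 n, Fin (mult q i) → Equiv.Perm (Fin i),
        (∏ i : Finset.Icc 1 n, ∏ k, (z i).coeff (g i k)) •
          of F _ (symmWreathPerm q e fun i : Finset.Icc 1 n => SemidirectProduct.inl (g i)) := by
  classical
  have h1 : (fun i : Finset.Icc 1 n => basePow (mult q i) (z i)) =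
      fun i : Finset.Icc 1 n => ∑ g : Fin (mult q i) → Equiv.Perm (Fin i), (∏ k, (z i).coeff (g k)) •
        of F (Wreath (Equiv.Perm (Fin i)) (mult q i)) (SemidirectProduct.inl g) := by
    funext i
    rw [basePow, piProd_eq_sum, map_sum]
    refine Finset.sum_congr rfl fun g _ => ?_
    refine (mapDomain_smul _ _ _).trans ?_
    exact congrArg _ mapDomain_single
  rw [blockProd, h1, piProd_sum_of, map_sum]
  refine Finset.sum_congr rfl fun g _ => ?_
  refine (mapDomain_smul _ _ _).trans ?_
  exact congrArg _ mapDomain_single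

theorem symmWreathPerm_inl (e : Letters q ≃ Fin n)
    (θ : (Σ i : Finset.Icc 1 n, Fin (mult q i)) ≃ Fin q.length)
    (g : ∀ i : Finset.Icc 1 n, Fin (mult q i) → Equiv.Perm (Fin i)) :
    symmWreathPerm q e (fun i => SemidirectProduct.inl (g i)) =
      (List.ofFn fun j => Equiv.Perm.viaEmbeddingHom (blockEmb e (θ.symm j))
        (g (θ.symm j).1 (θ.symm j).2)).prod := by
  have h1 : (List.ofFn fun j => Equiv.Perm.viaEmbeddingHom (blockEmb e (θ.symm j))
      (g (θ.symm j).1 (θ.symm j).2)) = (List.ofFn θ.symm).map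
        fun s => Equiv.Perm.viaEmbeddingHom (blockEmb e s) (g s.1 s.2) := by
    rw [List.map_ofFn]
    rfl
  rw [h1]
  ext y
  obtain ⟨⟨i, k, x⟩, rfl⟩ := e.surjective y
  have h2 := list_prod_viaEmbedding_apply e (fun s => g s.1 s.2) (List.ofFn θ.symm)
    (List.nodup_ofFn.2 θ.symm.injective) ⟨i, k⟩ x
  rw [if_pos ((List.mem_ofFn' _ _).2 (θ.symm.surjective _))] at h2
  rw [symmWreathPerm_apply]
  exact congrArg Fin.val h2.symm

/-- Both sides are expanded multilinearly over tuples of permutations, one for each part; the terms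
agree because permutations supported on disjoint blocks may be multiplied in any order. -/
theorem IsMatching.blockProd_eq (h : IsMatching q e θ)
    (z : ∀ i, MonoidAlgebra F (Equiv.Perm (Fin i))) :
    blockProd q e z = (List.ofFn fun j : Fin q.length => mapDomainRingHom F
      (Equiv.Perm.viaEmbeddingHom (q.embedding j).toEmbedding) (z (q.blocksFun j))).prod := by
  classical
  have h1 : ∀ j : Fin q.length, mapDomainRingHom F
      (Equiv.Perm.viaEmbeddingHom (q.embedding j).toEmbedding) (z (q.blocksFun j)) =
      ∑ g : Equiv.Perm (Fin (θ.symm j).1), (z (θ.symm j).1).coeff g •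
        of F _ (Equiv.Perm.viaEmbeddingHom (blockEmb e (θ.symm j)) g) := by
    intro j
    -- The length is made a variable so that the equality of lengths can be eliminated.
    have h2 : ∀ (i : ℕ) (hi : q.blocksFun j = i) (f : Fin i ↪ Fin n)
        (_ : ∀ x, f x = q.embedding j (Fin.cast hi.symm x)),
        mapDomainRingHom F
          (Equiv.Perm.viaEmbeddingHom (q.embedding j).toEmbedding) (z (q.blocksFun j)) =
        ∑ g : Equiv.Perm (Fin i), (z i).coeff g •
          of F _ (Equiv.Perm.viaEmbeddingHom f g) := by
      rintro i rfl f hf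
      have hf' : f = (q.embedding j).toEmbedding := by
        ext x
        rw [hf]
        rfl
      rw [hf']
      conv_lhs => rw [eq_sum_coeff (z (q.blocksFun j)), map_sum]
      refine Finset.sum_congr rfl fun g _ => ?_
      refine (mapDomain_smul _ _ _).trans ?_
      exact congrArg _ mapDomain_single
    have h3 := h.length (θ.symm j)
    have h4 := h.apply (θ.symm j)
    rw [θ.apply_symm_apply] at h3
    refine h2 _ h3 _ fun x => ?_
    refine (h4 x).trans (Fin.ext ?_)
    rw [q.coe_embedding, q.coe_embedding, Fin.val_cast, Fin.val_cast, θ.apply_symm_apply]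
  rw [blockProd_eq_sum]
  simp only [h1]
  rw [list_prod_sum_smul_of]
  refine Fintype.sum_equiv ((Equiv.piCurry _).symm.trans (Equiv.piCongrLeft' _ θ)) _ _ fun g => ?_
  congr 1
  · let f : (Σ i : Finset.Icc 1 n, Fin (mult q i)) → F := fun s =>
      (z s.1).coeff (g s.1 s.2)
    exact (Fintype.prod_sigma f).symm.trans (θ.symm.prod_comp f).symm
  · exact congrArg _ (symmWreathPerm_inl e θ g)

theorem IsMatching.blockProd_omega (h : IsMatching q e θ) (F : Type u) [Field F] :
    blockProd q e (fun i => omega F i) = omegaUpper F q :=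
  h.blockProd_eq _

end Matching

/-! ### Comparison of the left ideals -/

section Main

variable {F : Type u} [Field F] {n : ℕ} {q : Composition n} {V : Type u} [AddCommGroup V]
  [Module F V] {ρ : Representation F (Equiv.Perm (Fin n)) V}

theorem prod_pow_mult_ne_zero (h : ∀ i ∈ q.blocks, (i : F) ≠ 0) :
    ∏ i : Finset.Icc 1 n, ((i : ℕ) : F) ^ mult q i ≠ 0 := by
  refine Finset.prod_ne_zero_iff.2 fun i _ => ?_
  by_cases hi : (i : ℕ) ∈ q.blocks
  · exact pow_ne_zero _ (h i hi)
  · rw [mult, List.count_eq_zero_of_not_mem hi, pow_zero]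
    exact one_ne_zero

theorem blockProd_omega_mul_self (q : Composition n) (e : Letters q ≃ Fin n) (F : Type u)
    [Field F] :
    blockProd q e (fun i => omega F i) * blockProd q e (fun i => omega F i) =
      (∏ i : Finset.Icc 1 n, ((i : ℕ) : F) ^ mult q i) • blockProd q e (fun i => omega F i) := by
  rw [← blockProd_mul, ← blockProd_smul]
  exact blockProd_congr q e fun i hi => omega_mul_omega (q.one_le_blocks hi)

/-- The left ideals generated by `ω_q` and by the Lie elements of the blocks, symmetrized over
the permutations of blocks of equal lengths, are isomorphic. -/
theorem isModel_omegaLower (h : ∀ i ∈ q.blocks, (i : F) ≠ 0) (e : Letters q ≃ Fin n)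
    (hρ : IsModel ρ (blockProd q e (fun i => omega F i) * blockPermSum q e F)) :
    IsModel ρ (omegaLower F q) := by
  obtain ⟨e', θ, he⟩ := exists_isMatching q
  set g : Equiv.Perm (Fin n) := e.symm.trans e'
  have h1 := blockProd_mul_blockPermSum_of_trans q e e' fun i => omega F i
  have hg : of F (Equiv.Perm (Fin n)) g⁻¹ * of F _ g = 1 := by
    rw [← map_mul, inv_mul_cancel, map_one]
  have hg' : of F (Equiv.Perm (Fin n)) g * of F _ g⁻¹ = 1 := by
    rw [← map_mul, mul_inv_cancel, map_one]
  -- The generators for e and e' are conjugate under g, so right multiplication by g⁻¹ and g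
  -- identifies their ideals.
  have h2 : IsModel ρ (blockProd q e' (fun i => omega F i) * blockPermSum q e' F) := by
    refine IsModel.congr (u := of F _ g⁻¹) (v := of F _ g) hρ ?_ ?_ ?_ ?_
    · refine Ideal.mem_span_singleton'.2 ⟨of F _ g⁻¹, ?_⟩
      rw [h1, ← mul_assoc, ← mul_assoc, hg, one_mul]
    · refine Ideal.mem_span_singleton'.2 ⟨of F _ g, ?_⟩
      rw [h1, mul_assoc _ (of F _ g⁻¹), hg, mul_one]
    · rw [mul_assoc, hg, mul_one]
    · rw [mul_assoc, hg', mul_one]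
  have hcomm := blockProd_mul_blockPermSum_comm q e' fun i => omega F i
  have hsq := blockProd_omega_mul_self q e' F
  rw [he.blockProd_omega, he.blockPermSum_eq] at h2 hcomm
  rw [he.blockProd_omega] at hsq
  set B := setSum F (blockMonoGroup q.index : Set (Equiv.Perm (Fin n)))
  refine IsModel.congr (u := 1) (v := 1) h2 ?_ ?_ (by simp) (by simp)
  · rw [mul_one]
    -- The middle of ω^q Ξ ω^q becomes B, which commutes with ω^q; idempotency of ω^q up to a scalar
    -- finishes. Inverting this scalar is where p must divide no part.
    have h3 : omegaUpper F q * omegaLower F q =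
        (∏ i : Finset.Icc 1 n, ((i : ℕ) : F) ^ mult q i) • (omegaUpper F q * B) := by
      rw [omegaLower, ← mul_assoc, omegaUpper_mul_solomon, mul_assoc, ← hcomm, ← mul_assoc, hsq,
        smul_mul_assoc]
    rw [← inv_smul_smul₀ (prod_pow_mult_ne_zero h) (omegaUpper F q * B), ← h3]
    exact Submodule.smul_of_tower_mem _ _
      (Ideal.mul_mem_left _ _ (Ideal.mem_span_singleton_self _))
  · rw [mul_one, omegaLower]
    obtain ⟨r, hr⟩ := Ideal.mem_span_singleton'.1 (solomon_mem_span q F)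
    rw [← hr, mul_assoc, ← hcomm]
    exact Ideal.mul_mem_left _ _ (Ideal.mem_span_singleton_self _)

/-- Blockwise isomorphisms of left ideals induce isomorphisms. -/
theorem IsModel.blockProd_congr {e : Letters q ≃ Fin n}
    {x y u v : ∀ i, MonoidAlgebra F (Equiv.Perm (Fin i))}
    (hρ : IsModel ρ (blockProd q e x * blockPermSum q e F))
    (hxu : ∀ i ∈ q.blocks, x i * u i ∈ Ideal.span {y i})
    (hyv : ∀ i ∈ q.blocks, y i * v i ∈ Ideal.span {x i})
    (hx : ∀ i ∈ q.blocks, x i * u i * v i = x i)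
    (hy : ∀ i ∈ q.blocks, y i * v i * u i = y i) :
    IsModel ρ (blockProd q e y * blockPermSum q e F) := by
  classical
  -- The multiplier written on all blocks commutes with the sum of block permutations, so the
  -- relations for each i multiply up blockwise.
  have key : ∀ {x y u : ∀ i, MonoidAlgebra F (Equiv.Perm (Fin i))},
      (∀ i ∈ q.blocks, x i * u i ∈ Ideal.span {y i}) →
        blockProd q e x * blockPermSum q e F * blockProd q e u ∈
          Ideal.span {blockProd q e y * blockPermSum q e F} := by
    intro x y u h
    choose! a ha using fun i hi => Ideal.mem_span_singleton'.1 (h i hi)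
    refine Ideal.mem_span_singleton'.2 ⟨blockProd q e a, ?_⟩
    rw [mul_assoc (blockProd q e x), ← blockProd_mul_blockPermSum_comm, ← mul_assoc, ← mul_assoc,
      ← blockProd_mul, ← blockProd_mul, HigherLie.blockProd_congr q e ha]
  have key' : ∀ {x u v : ∀ i, MonoidAlgebra F (Equiv.Perm (Fin i))},
      (∀ i ∈ q.blocks, x i * u i * v i = x i) →
        blockProd q e x * blockPermSum q e F * blockProd q e u * blockProd q e v =
          blockProd q e x * blockPermSum q e F := by
    intro x u v h
    rw [mul_assoc (blockProd q e x), ← blockProd_mul_blockPermSum_comm, ← mul_assoc,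
      mul_assoc _ (blockPermSum q e F), ← blockProd_mul_blockPermSum_comm, ← mul_assoc,
      ← blockProd_mul, ← blockProd_mul, HigherLie.blockProd_congr q e h]
  exact IsModel.congr hρ (key hxu) (key hyv) (key' hx) (key' hy)

/-- Characters of the cyclic groups that are faithful whenever possible. -/
theorem exists_characters (F : Type u) [Field F] (p : ℕ) : ∃ δ : ∀ i : ℕ, cyc i →* F,
    ∀ i : ℕ, ¬ p ∣ i → (∃ ζ : F, IsPrimitiveRoot ζ i) →
      IsPrimitiveRoot (δ i (cycGen i)) i := by
  have h : ∀ i : ℕ, ∃ χ : cyc i →* F, ¬ p ∣ i → (∃ ζ : F, IsPrimitiveRoot ζ i) →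
      IsPrimitiveRoot (χ (cycGen i)) i := by
    intro i
    by_cases h : ¬ p ∣ i ∧ ∃ ζ : F, IsPrimitiveRoot ζ i
    · obtain ⟨hp, ζ, hζ⟩ := h
      have : NeZero i := ⟨fun h => hp (h ▸ dvd_zero p)⟩
      obtain ⟨χ, hχ⟩ := exists_cyc_character hζ.pow_eq_one
      exact ⟨χ, fun _ _ => hχ ▸ hζ⟩
    -- Where no faithful character is demanded, the trivial one serves as a default.
    · exact ⟨1, fun h1 h2 => absurd ⟨h1, h2⟩ h⟩
  choose δ hδ using h
  exact ⟨δ, hδ⟩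

end Main

end

end HigherLie

theorem theoremT (F : Type*) [Field F] [Infinite F] (p : ℕ) [CharP F p] :
    (∀ (n : ℕ) (q : Composition n) (e : HigherLie.Letters q ≃ Fin n),
      (∀ i ∈ q.blocks, ¬ p ∣ i) →
      Nonempty ((HigherLie.higherLie F q).Equiv
        (HigherLie.inducedWreath (fun i => MonoidHom.id (Equiv.Perm (Fin i)))
          (fun i => HigherLie.lieModule F i) q e))) ∧
    ∃ δ : ∀ i : ℕ, HigherLie.cyc i →* F,
      (∀ i : ℕ, ¬ p ∣ i → (∃ ζ : F, IsPrimitiveRoot ζ i) →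
        IsPrimitiveRoot (δ i (HigherLie.cycGen i)) i) ∧
      ∀ (n : ℕ) (q : Composition n) (e : HigherLie.Letters q ≃ Fin n),
        (∀ i ∈ q.blocks, ¬ p ∣ i) →
        (∀ i ∈ q.blocks, ∃ ζ : F, IsPrimitiveRoot ζ i) →
        Nonempty ((HigherLie.higherLie F q).Equiv
          (HigherLie.inducedWreath (fun i => (HigherLie.cyc i).subtype)
            (fun i => HigherLie.oneDim (δ i)) q e)) := by
  classical
  have hp : ∀ {n : ℕ} {q : Composition n}, (∀ i ∈ q.blocks, ¬ p ∣ i) →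
      ∀ i ∈ q.blocks, (i : F) ≠ 0 := fun h i hi h0 => h i hi ((CharP.cast_eq_zero_iff F p i).1 h0)
  refine ⟨fun n q e h => ?_, ?_⟩
  · have h1 := HigherLie.isModel_inducedWreath q e
      (φ := fun i => MonoidHom.id (Equiv.Perm (Fin i))) (fun _ => Function.injective_id)
      fun i => HigherLie.isModel_generatedRep (HigherLie.omega F i)
    simp only [MonoidAlgebra.mapDomainRingHom_id, RingHom.id_apply] at h1
    exact (HigherLie.isModel_omegaLower (hp h) e h1).nonempty_equiv
  · obtain ⟨δ, hδ⟩ := HigherLie.exists_characters F p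
    refine ⟨δ, hδ, fun n q e h hq => ?_⟩
    have h1 := HigherLie.isModel_inducedWreath q e
      (φ := fun i => (HigherLie.cyc i).subtype) (fun _ => Subtype.val_injective)
      fun i => HigherLie.isModel_oneDim (δ i)
    have h2 : ∀ i ∈ q.blocks, ∃ u v : MonoidAlgebra F (Equiv.Perm (Fin i)),
        HigherLie.omega F i * u ∈ Ideal.span {HigherLie.cycSum (δ i)} ∧
        HigherLie.cycSum (δ i) * v ∈ Ideal.span {HigherLie.omega F i} ∧
        HigherLie.omega F i * u * v = HigherLie.omega F i ∧
        HigherLie.cycSum (δ i) * v * u = HigherLie.cycSum (δ i) := by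
      intro i hi
      have : NeZero i := ⟨Nat.ne_of_gt (q.one_le_blocks hi)⟩
      exact HigherLie.exists_omega_cycSum_inverse (hδ i (h i hi) (hq i hi))
    choose! u v huv using h2
    -- The transfer runs from the cyclic character sums to the Lie elements, hence u and v exchange
    -- roles.
    have h3 := HigherLie.IsModel.blockProd_congr (y := fun i => HigherLie.omega F i) (u := v)
      (v := u) h1 (fun i hi => (huv i hi).2.1) (fun i hi => (huv i hi).1)
      (fun i hi => (huv i hi).2.2.2) (fun i hi => (huv i hi).2.2.1)
    exact (HigherLie.isModel_omegaLower (hp h) e h3).nonempty_equiv
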